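/- **Setting.** Let $L\ge 1$ be an integer and let $\mathbb T^L=\mathbb R^L/(2\pi\mathbb Z)^L$ be the flat torus with angular coordinates $\theta_1,\dots,\theta_L$. For $\vec m\in\mathbb Z^L$ put $p(\vec m)=\sqrt2\,(2\pi)^{-L/2}$ if $\vec m\ne 0$, $p(\vec 0)=(2\pi)^{-L/2}$, and $$\widehat A_{\vec m}=p(\vec m)\cos\Big(\sum_j m_j\theta_j\Big),\qquad \widehat B_{\vec m}=p(\vec m)\sin\Big(\sum_j m_j\theta_j\Big).$$ Let $\mathcal C_L\subset\mathbb Z^L$ be the set of vectors whose first nonzero entry is positive. A finite set $\mathcal M\subset\mathcal C_L$ is *symmetric* if for all $\vec m\in\mathcal C_L$ and all permutations $\varphi$ of $\{1,\dots,L\}$ we have $(m_1,\dots,m_L)\in\mathcal M\iff(m_{\varphi(1)},\dots,m_{\varphi(L)})\in\mathcal M\cup(-\mathcal M)$. Let $\boldsymbol V(\mathcal M)=\mathrm{span}\{\widehat A_{\vec m},\widehat B_{\vec m}:\vec m\in\mathcal M\}$, with the $L^2(\mathbb T^L)$ inner product $(-,-)$, and set $$a_{jk}=\frac{2}{(2\pi)^L}\sum_{\vec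 m\in\mathcal M}m_jm_k,\qquad \vec a_{jk}=-\frac{2^{1/2}}{(2\pi)^{L/2}}\sum_{\vec m\in\mathcal M}m_jm_k\,\widehat A_{\vec m}\in\boldsymbol V(\mathcal M).$$ If $\mathcal M$ is symmetric, then $a_{jj}$ does not depend on $j$ and $a_{jk}$, $j\neq k$, does not depend on $j\ne k$; the common values are denoted by $a$ and $b$ (with $b:=0$ if $L=1$). The space $\boldsymbol V(\mathcal M)$ is *ample* if for every $x\in\mathbb T^L$ and every covector $\xi\in T_x^*\mathbb T^L$ there is $v\in\boldsymbol V(\mathcal M)$ with $d_xv=\xi$. The expected number $\mu(\mathcal M)$ of critical points is the average, with respect to the area measure, of the number of critical points of $v$ over the unit sphere of $\boldsymbol V(\mathcal M)$. Let $\mathrm{Sym}_L$ be the Euclidean space of real symmetric $L\times L$ matrices with orthonormal basis $(H_{ij})_{1\le i\le j\le L}$, where $H_{ij}$ has entries $1$ at the locations $(i,j)$ and $(j,i)$ and $0$ elsewhere, with inner product $\langle-,-\rangle$ and volume element $|dX|=\prod_{i\le j}dx_{ij}$ for $X=\sum_{i\le j}x_{ij}H_{ij}$. **Theorem.** Suppose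 that $\mathcal M\subset\mathcal C_L$ is a symmetric finite set of cardinality $N>L$. (a) $\boldsymbol V(\mathcal M)$ is ample if and only if $a\ne b$ and $a+(L-1)b\neq 0$. (b) Suppose that the vectors $\vec a_{ij}$, $1\le i\le j\le L$, are linearly independent. Let $\boldsymbol C:\mathrm{Sym}_L\to\mathrm{Sym}_L$ be the symmetric operator whose matrix in the basis $(H_{ij})$ is $\boldsymbol C_{ij;k\ell}=(\vec a_{ij},\vec a_{k\ell})$. Then $$\boldsymbol C_{ij;k\ell}=\frac{2}{(2\pi)^L}\sum_{\vec m\in\mathcal M}m_im_jm_km_\ell$$ and $$\mu(\mathcal M)=\frac{1}{(2\pi)^{\frac12\binom L2}\,(a-b)^{\frac{L-1}{2}}\,\bigl(a+(L-1)b\bigr)^{1/2}\,(\det\boldsymbol C)^{1/2}}\int_{\mathrm{Sym}_L}e^{-\frac12\langle\boldsymbol C^{-1}X,X\rangle}\,|\det X|\,|dX|.$$ In particular $\mu(\mathcal M)$ is finite. -/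

import Mathlib

open MeasureTheory
open scoped ENNReal

noncomputable section

namespace TrigNewton

instance two_pi_pos_fact : Fact (0 < 2 * Real.pi) := ⟨Real.two_pi_pos⟩

/-- The flat torus `ℝ^L / (2πℤ)^L`. Its `volume` is the product of the arc length measures, of
total mass `(2π)^L`. -/
abbrev Torus (L : ℕ) : Type := Fin L → AddCircle (2 * Real.pi)

/-- The covering map `ℝ^L → ℝ^L / (2πℤ)^L`. -/
def proj {L : ℕ} (t : EuclideanSpace ℝ (Fin L)) : Torus L :=
  fun j => ((t j : ℝ) : AddCircle (2 * Real.pi))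

/-- The cosine as a function on the circle `ℝ / 2πℤ`. -/
def circleCos : AddCircle (2 * Real.pi) → ℝ := Real.cos_periodic.lift

/-- The sine as a function on the circle `ℝ / 2πℤ`. -/
def circleSin : AddCircle (2 * Real.pi) → ℝ := Real.sin_periodic.lift

theorem continuous_circleCos : Continuous circleCos :=
  continuous_coinduced_dom.mpr Real.continuous_cos

theorem continuous_circleSin : Continuous circleSin :=
  continuous_coinduced_dom.mpr Real.continuous_sin

/-! ### Differentials, critical points, ampleness -/

/-- `f` is differentiable at the point `x` of the torus with differential `ξ`. The tangent space at
`x` is identified with `ℝ^L` through the angular coordinates. -/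
def HasDifferentialAt {L : ℕ} (f : Torus L → ℝ) (ξ : EuclideanSpace ℝ (Fin L) →L[ℝ] ℝ)
    (x : Torus L) : Prop :=
  HasFDerivAt (fun t : EuclideanSpace ℝ (Fin L) => f (x + proj t)) ξ 0

/-- The set of critical points of `f`. -/
def criticalSet {L : ℕ} (f : Torus L → ℝ) : Set (Torus L) :=
  {x | HasDifferentialAt f 0 x}

/-- A space of functions on the torus is ample if at every point every covector is the differential
of some function of the space. -/
def IsAmple {L : ℕ} (V : Submodule ℝ C(Torus L, ℝ)) : Prop :=
  ∀ (x : Torus L) (ξ : EuclideanSpace ℝ (Fin L) →L[ℝ] ℝ), ∃ v ∈ V, HasDifferentialAt v ξ x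

/-! ### The `L²` inner product and the expected number of critical points -/

/-- The `L²` inner product on the torus. -/
def l2Inner {L : ℕ} (f g : C(Torus L, ℝ)) : ℝ := ∫ x, f x * g x

theorem integrable_mul {L : ℕ} (f g : C(Torus L, ℝ)) :
    Integrable (fun x => f x * g x) (volume : Measure (Torus L)) :=
  (f * g).continuous.integrable_of_hasCompactSupport
    (HasCompactSupport.of_compactSpace _)

theorem eq_zero_of_l2Inner_self {L : ℕ} (f : C(Torus L, ℝ)) (h : l2Inner f f = 0) : f = 0 := by
  have h1 := (integral_eq_zero_iff_of_nonneg (fun x => mul_self_nonneg (f x))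
    (integrable_mul f f)).1 h
  have h2 := (Continuous.ae_eq_iff_eq (volume : Measure (Torus L)) (f * f).continuous
    continuous_zero).1 h1
  ext x
  exact mul_self_eq_zero.1 (congrFun h2 x)

/-- The vector space `V`, as a type that carries the norm of `L²` (and not the sup norm). -/
def L2Space {L : ℕ} (V : Submodule ℝ C(Torus L, ℝ)) : Type := V

section L2Space

variable {L : ℕ} (V : Submodule ℝ C(Torus L, ℝ))

instance : AddCommGroup (L2Space V) := inferInstanceAs (AddCommGroup V)

instance : Module ℝ (L2Space V) := inferInstanceAs (Module ℝ V)

instance [h : FiniteDimensional ℝ V] : FiniteDimensional ℝ (L2Space V) := h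

/-- An element of `L2Space V` as a function on the torus. -/
def L2Space.toFun {V : Submodule ℝ C(Torus L, ℝ)} (v : L2Space V) : C(Torus L, ℝ) :=
  Submodule.subtype V v

/-- The inner product of `L2Space V` is `l2Inner`. -/
abbrev l2Core : InnerProductSpace.Core ℝ (L2Space V) where
  inner f g := l2Inner f.toFun g.toFun
  conj_inner_symm f g := by simp [l2Inner, mul_comm]
  re_inner_nonneg f := integral_nonneg fun x => mul_self_nonneg _
  add_left f g h := by
    have : (f + g).toFun = f.toFun + g.toFun := rfl
    simp only [l2Inner, this, ContinuousMap.add_apply, add_mul]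
    exact integral_add (integrable_mul _ _) (integrable_mul _ _)
  smul_left f g r := by
    have : (r • f).toFun = r • f.toFun := rfl
    simp only [l2Inner, this, ContinuousMap.smul_apply, smul_eq_mul, mul_assoc]
    exact integral_const_mul _ _
  definite f h := Subtype.ext (eq_zero_of_l2Inner_self f.toFun h)

instance : NormedAddCommGroup (L2Space V) :=
  @InnerProductSpace.Core.toNormedAddCommGroup ℝ (L2Space V) _ _ _ (l2Core V)

instance : InnerProductSpace ℝ (L2Space V) :=
  InnerProductSpace.ofCore (l2Core V).toCore

instance : MeasurableSpace (L2Space V) := borel _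

instance : BorelSpace (L2Space V) := ⟨rfl⟩

/-- The expected number of critical points of a random function of `V`: the average, with respect to
the area measure, of the number of critical points over the unit sphere of `V`, where `V` carries
the `L²` inner product. It is an element of `[0, ∞]`. -/
def expectedCritical [FiniteDimensional ℝ V] : ℝ≥0∞ :=
  (∫⁻ v : Metric.sphere (0 : L2Space V) 1,
      ((criticalSet (v : L2Space V).toFun).encard : ℝ≥0∞)
        ∂((volume : Measure (L2Space V)).toSphere)) /
    ((volume : Measure (L2Space V)).toSphere Set.univ)

end L2Space

/-! ### Trigonometric polynomials with given frequencies -/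

/-- The normalizing factor `p(m)`. -/
def normFactor {L : ℕ} (m : Fin L → ℤ) : ℝ :=
  if m = 0 then 1 / (2 * Real.pi) ^ ((L : ℝ) / 2) else √2 / (2 * Real.pi) ^ ((L : ℝ) / 2)

/-- The function `p(m) cos (m₁θ₁ + ⋯ + m_Lθ_L)`. -/
def cosFun {L : ℕ} (m : Fin L → ℤ) : C(Torus L, ℝ) where
  toFun θ := normFactor m * circleCos (∑ j, m j • θ j)
  continuous_toFun := by
    have := continuous_circleCos
    fun_prop

/-- The function `p(m) sin (m₁θ₁ + ⋯ + m_Lθ_L)`. -/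
def sinFun {L : ℕ} (m : Fin L → ℤ) : C(Torus L, ℝ) where
  toFun θ := normFactor m * circleSin (∑ j, m j • θ j)
  continuous_toFun := by
    have := continuous_circleSin
    fun_prop

/-- The positive cone of `ℤ^L` for the lexicographic order: the vectors whose first nonzero entry is
positive. -/
def posCone (L : ℕ) : Set (Fin L → ℤ) := {m | ∃ i, 0 < m i ∧ ∀ j < i, m j = 0}

/-- A set `M` of frequencies in the positive cone is symmetric if, for every `m` in the cone and
every permutation `σ` of the coordinates, `m ∈ M` if and only if the permuted vector lies in
`M ∪ -M`. -/
def IsSymmetric {L : ℕ} (M : Finset (Fin L → ℤ)) : Prop :=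
  ∀ (σ : Equiv.Perm (Fin L)), ∀ m ∈ posCone L,
    (m ∈ M ↔ (fun i => m (σ i)) ∈ M ∨ -(fun i => m (σ i)) ∈ M)

/-- The space `V(M)` of trigonometric polynomials. -/
def trigSpace {L : ℕ} (M : Finset (Fin L → ℤ)) : Submodule ℝ C(Torus L, ℝ) :=
  Submodule.span ℝ (cosFun '' (M : Set (Fin L → ℤ)) ∪ sinFun '' (M : Set (Fin L → ℤ)))

instance {L : ℕ} (M : Finset (Fin L → ℤ)) : FiniteDimensional ℝ (trigSpace M) :=
  FiniteDimensional.span_of_finite ℝ ((M.finite_toSet.image _).union (M.finite_toSet.image _))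

/-- The scalars `a_{jk}(M)`. -/
def aCoef {L : ℕ} (M : Finset (Fin L → ℤ)) (j k : Fin L) : ℝ :=
  2 / (2 * Real.pi) ^ L * ∑ m ∈ M, (m j : ℝ) * (m k : ℝ)

/-- The common value `a(M)` of the diagonal scalars `a_{jj}(M)` of a symmetric set. -/
def aDiag {L : ℕ} (M : Finset (Fin L → ℤ)) : ℝ :=
  if h : 0 < L then aCoef M ⟨0, h⟩ ⟨0, h⟩ else 0

/-- The common value `b(M)` of the scalars `a_{jk}(M)`, `j ≠ k`, of a symmetric set; it is `0` by
convention if `L = 1`, when there are no such scalars. -/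
def bOff {L : ℕ} (M : Finset (Fin L → ℤ)) : ℝ :=
  if h : 1 < L then aCoef M ⟨0, by omega⟩ ⟨1, h⟩ else 0

theorem posCone_or_neg {L : ℕ} (m : Fin L → ℤ) (h : m ≠ 0) : m ∈ posCone L ∨ -m ∈ posCone L := by
  classical
  have hne : ∃ i, m i ≠ 0 := by
    by_contra hc
    push Not at hc
    exact h (funext hc)
  obtain ⟨i, hi, hmin⟩ := WellFounded.has_min (wellFounded_lt (α := Fin L)) {i | m i ≠ 0} hne
  have hz : ∀ j < i, m j = 0 := fun j hj => by
    by_contra hc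
    exact hmin j hc hj
  rcases lt_or_gt_of_ne (show m i ≠ 0 from hi) with h1 | h1
  · exact Or.inr ⟨i, by simpa using h1, fun j hj => by simp [hz j hj]⟩
  · exact Or.inl ⟨i, h1, hz⟩

theorem posCone_ne_zero {L : ℕ} {m : Fin L → ℤ} (h : m ∈ posCone L) : m ≠ 0 := by
  rintro rfl
  obtain ⟨i, hi, _⟩ := h
  simp at hi

theorem posCone_not_neg {L : ℕ} {m : Fin L → ℤ} (h : m ∈ posCone L) : -m ∉ posCone L := by
  rintro ⟨k, hk, hk'⟩
  obtain ⟨i, hi, hi'⟩ := h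
  simp only [Pi.neg_apply] at hk hk'
  rcases lt_trichotomy i k with hl | hl | hl
  · have := hk' i hl
    omega
  · subst hl
    omega
  · have := hi' k hl
    omega

/-- The scalars `a_{jk}` of a symmetric set are invariant under permutations of the indices. -/
theorem aCoef_perm {L : ℕ} {M : Finset (Fin L → ℤ)} (hM : ∀ m ∈ M, m ∈ posCone L)
    (hs : IsSymmetric M) (σ : Equiv.Perm (Fin L)) (j k : Fin L) :
    aCoef M (σ j) (σ k) = aCoef M j k := by
  classical
  unfold aCoef
  congr 1
  have hperm0 : ∀ m : Fin L → ℤ, (fun i => m (σ i)) = 0 → m = 0 := fun m h => by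
    funext i
    simpa using congrFun h (σ.symm i)
  let e : (Fin L → ℤ) → (Fin L → ℤ) := fun m =>
    if (fun i => m (σ i)) ∈ M then (fun i => m (σ i)) else -(fun i => m (σ i))
  refine Finset.sum_bij (fun m _ => e m) ?_ ?_ ?_ ?_
  · intro m hm
    rcases (hs σ m (hM m hm)).1 hm with h | h
    · simp [e, h]
    · by_cases h2 : (fun i => m (σ i)) ∈ M
      · simp [e, h2]
      · simpa only [e, if_neg h2] using h
  · intro m hm n hn hmn
    have key : (fun i => m (σ i)) = (fun i => n (σ i)) ∨
        (fun i => m (σ i)) = -(fun i => n (σ i)) := by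
      dsimp only [e] at hmn
      split_ifs at hmn with h1 h2 h2
      · exact Or.inl hmn
      · exact Or.inr hmn
      · exact Or.inr (by rw [← hmn, neg_neg])
      · exact Or.inl (neg_injective hmn)
    rcases key with h | h
    · funext i
      simpa using congrFun h (σ.symm i)
    · exfalso
      have hneg : n = -m := by
        funext i
        have := congrFun h (σ.symm i)
        simp only [Pi.neg_apply, Equiv.apply_symm_apply] at this ⊢
        omega
      exact posCone_not_neg (hM m hm) (hneg ▸ hM n hn)
  · intro n hn
    have hn0 := posCone_ne_zero (hM n hn)
    have hq0 : (fun i => n (σ.symm i)) ≠ 0 := fun h => hn0 (by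
      funext i
      simpa using congrFun h (σ i))
    rcases posCone_or_neg _ hq0 with h | h
    · have hb : (fun i => (fun i => n (σ.symm i)) (σ i)) = n := by
        funext i
        simp
      refine ⟨fun i => n (σ.symm i), (hs σ _ h).2 (Or.inl (by rw [hb]; exact hn)), ?_⟩
      dsimp only [e]
      simp [hn]
    · have hb : (fun i => (-(fun i => n (σ.symm i))) (σ i)) = -n := by
        funext i
        simp
      refine ⟨-(fun i => n (σ.symm i)), (hs σ _ h).2 (Or.inr ?_), ?_⟩
      · rw [hb, neg_neg]
        exact hn
      · have hnot : -n ∉ M := fun hc => posCone_not_neg (hM n hn) (hM _ hc)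
        dsimp only [e]
        rw [hb, if_neg hnot, neg_neg]
  · intro m hm
    dsimp only [e]
    split_ifs <;> simp

/-- The diagonal scalars of a symmetric set all equal `aDiag`. -/
theorem aCoef_diag {L : ℕ} {M : Finset (Fin L → ℤ)} (hM : ∀ m ∈ M, m ∈ posCone L)
    (hs : IsSymmetric M) (j : Fin L) : aCoef M j j = aDiag M := by
  have hL : 0 < L := j.pos
  rw [aDiag, dif_pos hL, ← aCoef_perm hM hs (Equiv.swap ⟨0, hL⟩ j) ⟨0, hL⟩ ⟨0, hL⟩]
  simp

/-- The off-diagonal scalars of a symmetric set all equal `bOff`. -/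
theorem aCoef_off {L : ℕ} {M : Finset (Fin L → ℤ)} (hM : ∀ m ∈ M, m ∈ posCone L)
    (hs : IsSymmetric M) {j k : Fin L} (hjk : j ≠ k) : aCoef M j k = bOff M := by
  have hL : 1 < L := by
    by_contra hc
    exact hjk (Fin.ext (by omega))
  have h0 : (⟨0, by omega⟩ : Fin L) ≠ ⟨1, hL⟩ := by simp
  rw [bOff, dif_pos hL]
  set z : Fin L := ⟨0, by omega⟩
  set o : Fin L := ⟨1, hL⟩
  rw [← aCoef_perm hM hs (Equiv.swap (Equiv.swap z j o) k * Equiv.swap z j) z o]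
  have h1 : Equiv.swap z j o ≠ j := fun h => h0 ((Equiv.swap z j).injective (by simp [h]))
  simp only [Equiv.Perm.mul_apply, Equiv.swap_apply_left]
  rw [Equiv.swap_apply_of_ne_of_ne h1.symm hjk]

/-- The vectors `a_{jk}(M)`; they lie in `V(M)`. -/
def aVec {L : ℕ} (M : Finset (Fin L → ℤ)) (j k : Fin L) : C(Torus L, ℝ) :=
  -(√2 / (2 * Real.pi) ^ ((L : ℝ) / 2)) • ∑ m ∈ M, ((m j : ℝ) * (m k : ℝ)) • cosFun m

/-! ### Symmetric matrices -/

/-- The index set of the basis `H_{ij}`, `i ≤ j`, of the space of symmetric matrices. -/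
abbrev SymIdx (L : ℕ) : Type := {p : Fin L × Fin L // p.1 ≤ p.2}

/-- The symmetric matrix `H_{ij}` with entry `1` at `(i, j)` and at `(j, i)`, and `0` elsewhere. -/
def symBasis {L : ℕ} (p : SymIdx L) : Matrix (Fin L) (Fin L) ℝ :=
  Matrix.of fun i j =>
    if (i = p.1.1 ∧ j = p.1.2) ∨ (i = p.1.2 ∧ j = p.1.1) then 1 else 0

/-- The symmetric matrix `X = ∑_{i ≤ j} x_{ij} H_{ij}` with coordinates `x` in the orthonormal basis
`H_{ij}` of the Euclidean space of symmetric matrices. -/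
def symMatrix {L : ℕ} (x : SymIdx L → ℝ) : Matrix (Fin L) (Fin L) ℝ := ∑ p, x p • symBasis p

/-- The matrix, in the basis `H_{ij}`, of the covariance operator: the Gram matrix of the vectors
`a_{ij}(M)`. -/
def covMatrix {L : ℕ} (M : Finset (Fin L → ℤ)) : Matrix (SymIdx L) (SymIdx L) ℝ :=
  Matrix.of fun p q => l2Inner (aVec M p.1.1 p.1.2) (aVec M q.1.1 q.1.2)

end TrigNewton

end

/-! Let `A` be the `L × N` matrix whose columns are the frequencies. At angular coordinates `y`,
rotate each pair of cosine and sine coefficients of `v` by the angle `(Aᵀ y)_m`. This gives value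
coefficients `a` and derivative coefficients `u`, and `dv` is a positive multiple of `A u`. Hence
ampleness means that `A` has rank `L`, i.e. that `det (A Aᵀ)` is nonzero. By symmetry `A Aᵀ` is, up
to scale, the matrix with constant diagonal `a(M)` and constant off-diagonal `b(M)`, whose
determinant is explicit (`isAmple_trigSpace_iff_ne`).

For the count, the incidence set of pairs (function, critical point) is flattened. A pair is given
by `a`, `u ∈ ker A` and `y`; put `z = u + Aᵀ y`. The kernel and the row space of `A` are orthogonal
complements, so `z` determines `u` and `y`, and `(a, z)` are linear coordinates on the incidence
set. In them the projection to `v` is the map `twist`, between spaces of equal dimension `2N`.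
Critical points of `v` are the points of its fiber with `y` in the box `[0, 2π)^L`
(`encard_criticalSet_trigFun`), so the ordinary area formula (`lintegral_encard_fiber`) gives their
Gaussian mean.

The Jacobian of `twist` is `|det (A D_a Aᵀ)| / det (A Aᵀ)`, where `D_a = diagonal a`, and the
Gaussian exponent splits as `|a|² + |u|²`, so the mean factors (`lintegral_encard_twist`). The count
does not change when `v` is rescaled, so the spherical and Gaussian averages agree
(`expectedCritical_eq_div`). Finally `A D_a Aᵀ`, up to sign and scale the Hessian at the critical
point, is linear in `a`. It is the symmetric matrix with coordinates `momentMatrix M *ᵥ a` up to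
scale, which for Gaussian `a` is Gaussian with covariance `covMatrix M`;
`lintegral_exp_mul_comp_mulVec` then turns the integral over `a` into the one over symmetric
matrices. -/

noncomputable section

namespace TrigNewton

/-! ### The area formula for maps that need not be injective. -/

section AreaFormula

variable {E : Type*} [NormedAddCommGroup E] [NormedSpace ℝ E] [FiniteDimensional ℝ E]
  [MeasurableSpace E] [BorelSpace E] (μ : Measure E) [μ.IsAddHaarMeasure]

open Set in
/-- A set on which a map is differentiable with invertible differentials is a countable disjoint
union of measurable pieces on which the map is injective. -/
theorem exists_injOn_partition {f : E → E} {s : Set E} {f' : E → E →L[ℝ] E}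
    (hs : MeasurableSet s) (hf' : ∀ x ∈ s, HasFDerivWithinAt f (f' x) s x)
    (hdet : ∀ x ∈ s, (f' x).det ≠ 0) :
    ∃ t : ℕ → Set E, Pairwise (Function.onFun Disjoint t) ∧ (∀ n, MeasurableSet (t n)) ∧
      s = ⋃ n, t n ∧ ∀ n, InjOn f (t n) := by
  classical
  rcases s.eq_empty_or_nonempty with rfl | hne
  · exact ⟨fun _ => ∅, fun _ _ _ => disjoint_bot_left, fun _ => MeasurableSet.empty, by simp,
      fun _ => by simp⟩
  have key : ∀ A : E →L[ℝ] E, ∃ r : NNReal, r ≠ 0 ∧ (A.det ≠ 0 → ∀ u : Set E,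
      ApproximatesLinearOn f A u r → InjOn f u) := by
    intro A
    by_cases hA : A.det = 0
    · exact ⟨1, one_ne_zero, fun h => absurd hA h⟩
    · let B : E ≃L[ℝ] E := A.toContinuousLinearEquivOfDetNeZero hA
      have hB : (B : E →L[ℝ] E) = A := by
        ext x
        simp [B]
      rcases subsingleton_or_nontrivial E with hE | hE
      · exact ⟨1, one_ne_zero, fun _ u _ => (Function.injective_of_subsingleton f).injOn⟩
      · have hpos : 0 < ‖(B.symm : E →L[ℝ] E)‖₊ := by
          simpa using B.subsingleton_or_nnnorm_symm_pos.resolve_left (not_subsingleton E)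
        refine ⟨‖(B.symm : E →L[ℝ] E)‖₊⁻¹ / 2, by positivity, fun _ u hu => ?_⟩
        rw [← hB] at hu
        exact hu.injOn (Or.inr (NNReal.half_lt_self (by positivity)))
  choose r hr hinj using key
  obtain ⟨t, A, hdisj, hmeas, hcov, happ, hA⟩ :=
    exists_partition_approximatesLinearOn_of_hasFDerivWithinAt f s f' hf' r hr
  refine ⟨fun n => s ∩ t n, fun i j hij => (hdisj hij).mono inter_subset_right inter_subset_right,
    fun n => hs.inter (hmeas n), ?_, fun n => ?_⟩
  · rw [← inter_iUnion, inter_eq_self_of_subset_left hcov]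
  -- The linear model of each piece is an actual differential `f' y` with `y ∈ s`, hence invertible.
  -- This is where nonemptiness of `s` enters.
  · obtain ⟨y, hy, hAy⟩ := hA hne n
    exact hinj (A n) (hAy ▸ hdet y hy) _ (happ n)

open Set in
/-- The area formula with multiplicities for maps with invertible differentials. -/
theorem lintegral_encard_fiber_of_det_ne_zero {f : E → E} {s : Set E} {f' : E → E →L[ℝ] E}
    (hs : MeasurableSet s) (hf' : ∀ x ∈ s, HasFDerivWithinAt f (f' x) s x)
    (hdet : ∀ x ∈ s, (f' x).det ≠ 0) {g : E → ℝ≥0∞} (hg : Measurable g) :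
    Measurable (fun y => ((s ∩ f ⁻¹' {y}).encard : ℝ≥0∞)) ∧
      ∫⁻ y, ((s ∩ f ⁻¹' {y}).encard : ℝ≥0∞) * g y ∂μ =
        ∫⁻ x in s, ENNReal.ofReal |(f' x).det| * g (f x) ∂μ := by
  obtain ⟨t, hdisj, hmeas, hst, hinj⟩ := exists_injOn_partition hs hf' hdet
  have hts : ∀ n, t n ⊆ s := fun n => hst ▸ subset_iUnion t n
  have hft : ∀ n, ∀ x ∈ t n, HasFDerivWithinAt f (f' x) (t n) x :=
    fun n x hx => (hf' x (hts n hx)).mono (hts n)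
  have himg : ∀ n, MeasurableSet (f '' t n) := fun n =>
    measurable_image_of_fderivWithin (hmeas n) (hft n) (hinj n)
  -- Each piece meets a fiber in at most one point, so the multiplicity is the number of images that
  -- contain `y`.
  have hcount : ∀ y, ((s ∩ f ⁻¹' {y}).encard : ℝ≥0∞) = ∑' n, (f '' t n).indicator 1 y := by
    intro y
    have hsub : ∀ n, (t n ∩ f ⁻¹' {y}).Subsingleton := fun n a ha b hb =>
      hinj n ha.1 hb.1 (ha.2.trans hb.2.symm)
    have hm : ∀ n, MeasurableSet (t n ∩ f ⁻¹' {y}) := fun n => (hsub n).measurableSet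
    have hu : s ∩ f ⁻¹' {y} = ⋃ n, t n ∩ f ⁻¹' {y} := by rw [hst, iUnion_inter]
    rw [← Measure.count_apply (hu ▸ MeasurableSet.iUnion hm), hu, measure_iUnion
      (fun i j hij => (hdisj hij).mono inter_subset_left inter_subset_left) hm]
    refine tsum_congr fun n => ?_
    rw [Measure.count_apply (hm n)]
    rcases (hsub n).eq_empty_or_singleton with h | ⟨x, h⟩
    · rw [h, indicator_of_notMem]
      · simp
      · rintro ⟨x, hx, hxy⟩
        exact (h ▸ (⟨hx, hxy⟩ : x ∈ t n ∩ f ⁻¹' {y}) : x ∈ (∅ : Set E))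
    · have hx : x ∈ t n ∩ f ⁻¹' {y} := h ▸ mem_singleton x
      rw [h, indicator_of_mem (show y ∈ f '' t n from ⟨x, hx.1, hx.2⟩)]
      simp
  have hmi : ∀ n, Measurable ((f '' t n).indicator (1 : E → ℝ≥0∞)) := fun n =>
    measurable_one.indicator (himg n)
  refine ⟨by simp only [hcount]; exact Measurable.tsum hmi, ?_⟩
  simp only [hcount, ← ENNReal.tsum_mul_right]
  rw [lintegral_tsum (f := fun n y => (f '' t n).indicator 1 y * g y)
    fun n => ((hmi n).mul hg).aemeasurable]
  rw [hst, lintegral_iUnion hmeas hdisj]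
  refine tsum_congr fun n => ?_
  rw [← lintegral_image_eq_lintegral_abs_det_fderiv_mul μ (hmeas n) (hft n) (hinj n),
    ← lintegral_indicator (himg n)]
  refine lintegral_congr fun y => ?_
  by_cases hy : y ∈ f '' t n <;> simp [hy]

open Set in
/-- The area formula with multiplicities. -/
theorem lintegral_encard_fiber {f : E → E} {s : Set E} {f' : E → E →L[ℝ] E}
    (hs : MeasurableSet s) (hf' : ∀ x ∈ s, HasFDerivWithinAt f (f' x) s x)
    (hdet : Measurable fun x => (f' x).det) {g : E → ℝ≥0∞} (hg : Measurable g) :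
    AEMeasurable (fun y => ((s ∩ f ⁻¹' {y}).encard : ℝ≥0∞)) μ ∧
      ∫⁻ y, ((s ∩ f ⁻¹' {y}).encard : ℝ≥0∞) * g y ∂μ =
        ∫⁻ x in s, ENNReal.ofReal |(f' x).det| * g (f x) ∂μ := by
  set Z : Set E := {x | (f' x).det = 0} with hZ
  have hZm : MeasurableSet Z := hdet (measurableSet_singleton 0)
  obtain ⟨h1, h2⟩ := lintegral_encard_fiber_of_det_ne_zero μ (hs.diff hZm)
    (fun x hx => (hf' x hx.1).mono sdiff_subset) (fun x hx => hx.2) hg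
  -- Sard: critical values are negligible, so almost every fiber avoids `Z`, while the Jacobian
  -- integrand vanishes on `Z`.
  have hnull : μ (f '' (s ∩ Z)) = 0 := addHaar_image_eq_zero_of_det_fderivWithin_eq_zero μ
    (fun x hx => (hf' x hx.1).mono inter_subset_left) (fun x hx => hx.2)
  have hae : (fun y => ((s ∩ f ⁻¹' {y}).encard : ℝ≥0∞)) =ᵐ[μ]
      fun y => (((s \ Z) ∩ f ⁻¹' {y}).encard : ℝ≥0∞) := by
    filter_upwards [measure_eq_zero_iff_ae_notMem.1 hnull] with y hy
    congr 2
    ext x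
    simp only [mem_inter_iff, mem_sdiff, mem_preimage, mem_singleton_iff]
    refine ⟨fun h => ⟨⟨h.1, fun hx => hy ⟨x, ⟨h.1, hx⟩, h.2⟩⟩, h.2⟩, fun h => ⟨h.1.1, h.2⟩⟩
  refine ⟨⟨_, h1, hae⟩, ?_⟩
  rw [lintegral_congr_ae (f := fun y => ((s ∩ f ⁻¹' {y}).encard : ℝ≥0∞) * g y)
    (g := fun y => (((s \ Z) ∩ f ⁻¹' {y}).encard : ℝ≥0∞) * g y)
    (hae.mul (ae_eq_refl g)), ← lintegral_inter_add_sdiff _ s hZm,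
    setLIntegral_congr_fun (g := fun _ => 0) (hs.inter hZm) (fun x hx => by
      simp [show (f' x).det = 0 from hx.2])]
  simpa using h2

end AreaFormula

/-! ### Polar coordinates for functions constant on rays. -/

section Polar

variable {E : Type*} [NormedAddCommGroup E] [NormedSpace ℝ E] [FiniteDimensional ℝ E]
  [MeasurableSpace E] [BorelSpace E] [Nontrivial E] (μ : Measure E) [μ.IsAddHaarMeasure]

open Set Metric in
/-- Integration in polar coordinates of the product of a function that is constant on rays and a
radial function. -/
theorem lintegral_mul_fun_norm_eq {n : E → ℝ≥0∞} (hn : AEMeasurable n μ)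
    (hhom : ∀ (r : ℝ) (v : E), 0 < r → n (r • v) = n v) {g : ℝ → ℝ≥0∞} (hg : Measurable g) :
    ∫⁻ v, n v * g ‖v‖ ∂μ = (∫⁻ v : sphere (0 : E) 1, n v ∂μ.toSphere) *
      ∫⁻ r, g r ∂(Measure.volumeIoiPow (Module.finrank ℝ E - 1)) := by
  have hmp := μ.measurePreserving_homeomorphUnitSphereProd
  have hsymm := hmp.symm (homeomorphUnitSphereProd E).toMeasurableEquiv
  set ν := Measure.volumeIoiPow (Module.finrank ℝ E - 1)
  have hν : ν ≠ 0 := by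
    intro h
    have := Measure.volumeIoiPow_apply_Iio (Module.finrank ℝ E - 1) ⟨1, mem_Ioi.2 zero_lt_one⟩
    rw [show Measure.volumeIoiPow (Module.finrank ℝ E - 1) = 0 from h] at this
    simp only [Measure.coe_zero, Pi.zero_apply] at this
    have h2 := ENNReal.ofReal_eq_zero.1 this.symm
    have : (0 : ℝ) < 1 ^ (Module.finrank ℝ E - 1 + 1) /
      (((Module.finrank ℝ E - 1 : ℕ) : ℝ) + 1) := by positivity
    exact absurd h2 (not_le.2 this)
  -- The sphere is a null set, so measurability does not restrict to it directly. By Fubini the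
  -- measurable representative agrees with `n` on almost all of the sphere of some radius `r` (such
  -- `r` exists since `ν ≠ 0`), and homogeneity carries this back to radius one.
  have hsph : AEMeasurable (fun v : sphere (0 : E) 1 => n v) μ.toSphere := by
    obtain ⟨n', hn', hae⟩ := hn
    have h1 : ∀ᵐ x : ({0}ᶜ : Set E) ∂(μ.comap (↑)), n x = n' x :=
      (MeasurableEmbedding.subtype_coe
        (measurableSet_singleton (0 : E)).compl).ae_map_iff.1 (by
          rw [map_comap_subtype_coe (measurableSet_singleton _).compl]
          exact ae_restrict_of_ae hae)
    have h2 : ∀ᵐ p ∂(μ.toSphere.prod ν),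
        n ((homeomorphUnitSphereProd E).symm p) = n' ((homeomorphUnitSphereProd E).symm p) :=
      hsymm.quasiMeasurePreserving.ae h1
    have h3 := Measure.ae_ae_of_ae_prod 
      ((Measure.measurePreserving_swap (μ := ν) (ν := μ.toSphere)).quasiMeasurePreserving.ae h2)
    have : (ae ν).NeBot := ae_neBot.2 hν
    obtain ⟨r, hr⟩ := h3.exists
    refine ⟨fun v => n' ((r : ℝ) • (v : E)), by fun_prop, ?_⟩
    filter_upwards [hr] with v hv
    rw [← hhom r v r.2]
    simpa using hv
  rw [← lintegral_prod_mul (f := fun v : sphere (0 : E) 1 => n v)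
    (g := fun r : Ioi (0 : ℝ) => g r) hsph (by fun_prop)]
  rw [← hmp.lintegral_comp_emb (homeomorphUnitSphereProd E).measurableEmbedding]
  rw [← restrict_compl_singleton (μ := μ) 0,
    ← lintegral_subtype_comap (measurableSet_singleton (0 : E)).compl,
    restrict_compl_singleton (μ := μ) 0]
  refine lintegral_congr fun v => ?_
  have hv : 0 < ‖(v : E)‖⁻¹ := inv_pos.2 (norm_pos_iff.2 v.2)
  simp [hhom _ (v : E) hv]

end Polar

/-! ### Linear images of Gaussian measures. -/

section GaussianFiber

open Matrix

/-- The integral of the standard Gaussian density (without its normalizing constant). -/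
theorem lintegral_exp_neg_half_dotProduct (ι : Type*) [Fintype ι] :
    ∫⁻ x : ι → ℝ, ENNReal.ofReal (Real.exp (-(1 / 2) * (x ⬝ᵥ x))) =
      ENNReal.ofReal (√(2 * Real.pi) ^ Fintype.card ι) := by
  have hexp : ∀ x : ι → ℝ, Real.exp (-(1 / 2) * (x ⬝ᵥ x)) =
      ∏ i, Real.exp (-(1 / 2) * x i ^ 2) := by
    intro x
    rw [← Real.exp_sum, dotProduct, Finset.mul_sum]
    simp [pow_two]
  have hint : Integrable fun x : ι → ℝ => ∏ i, Real.exp (-(1 / 2) * x i ^ 2) :=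
    Integrable.fintype_prod (f := fun _ t => Real.exp (-(1 / 2) * t ^ 2))
      fun _ => integrable_exp_neg_mul_sq (by norm_num)
  simp only [hexp]
  rw [← ofReal_integral_eq_lintegral_ofReal hint
    (Filter.Eventually.of_forall fun x => Finset.prod_nonneg fun i _ => (Real.exp_pos _).le),
    integral_fintype_prod_volume_eq_pow (fun t : ℝ => Real.exp (-(1 / 2) * t ^ 2)),
    integral_gaussian]
  congr 3
  ring

/-- Linear change of variables. -/
theorem lintegral_comp_mulVec {κ : Type*} [Fintype κ] [DecidableEq κ] {B : Matrix κ κ ℝ}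
    (hB : B.det ≠ 0) {h : (κ → ℝ) → ℝ≥0∞} (hh : Measurable h) :
    ∫⁻ y, h (B *ᵥ y) = ENNReal.ofReal |B.det|⁻¹ * ∫⁻ y, h y := by
  have h1 := Real.map_matrix_volume_pi_eq_smul_volume_pi hB
  have h2 : Measurable (Matrix.toLin' B) := (Matrix.toLin' B).continuous_of_finiteDimensional.measurable
  have h3 := lintegral_map (μ := volume) hh h2
  rw [h1, lintegral_smul_measure] at h3
  simp only [Matrix.toLin'_apply] at h3
  rw [← h3, abs_inv]
  rfl

theorem exists_transpose_mul_self_eq {κ : Type*} [Fintype κ] [DecidableEq κ] {Q : Matrix κ κ ℝ}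
    (hQ : Q.PosDef) : ∃ B : Matrix κ κ ℝ, Bᵀ * B = Q := by
  open scoped MatrixOrder Matrix.Norms.L2Operator in
  refine ⟨CFC.sqrt Q, ?_⟩
  have h1 := CFC.sqrt_mul_sqrt_self Q hQ.posSemidef.nonneg
  have h2 : (CFC.sqrt Q).PosSemidef := Matrix.nonneg_iff_posSemidef.1 (CFC.sqrt_nonneg Q)
  have h3 := h2.1
  rw [Matrix.IsHermitian, Matrix.conjTranspose_eq_transpose_of_trivial] at h3
  rw [h3, h1]

/-- The integral of a Gaussian density (without its normalizing constant). -/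
theorem lintegral_exp_neg_half_quadratic {κ : Type*} [Fintype κ] [DecidableEq κ]
    {Q : Matrix κ κ ℝ} (hQ : Q.PosDef) :
    ∫⁻ y : κ → ℝ, ENNReal.ofReal (Real.exp (-(1 / 2) * ((Q *ᵥ y) ⬝ᵥ y))) =
      ENNReal.ofReal ((√Q.det)⁻¹ * √(2 * Real.pi) ^ Fintype.card κ) := by
  obtain ⟨B, rfl⟩ := exists_transpose_mul_self_eq hQ
  have hdet := hQ.det_pos
  have hd : (Bᵀ * B).det = B.det * B.det := by rw [det_mul, det_transpose]
  rw [hd] at hdet ⊢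
  have hB : B.det ≠ 0 := fun h => by simp [h] at hdet
  have hq : ∀ y, ((Bᵀ * B) *ᵥ y) ⬝ᵥ y = (B *ᵥ y) ⬝ᵥ (B *ᵥ y) := by
    intro y
    rw [← mulVec_mulVec, mulVec_transpose, ← dotProduct_mulVec]
  simp only [hq]
  rw [lintegral_comp_mulVec hB
    (h := fun y => ENNReal.ofReal (Real.exp (-(1 / 2) * (y ⬝ᵥ y)))) (by
      unfold dotProduct; fun_prop),
    lintegral_exp_neg_half_dotProduct, ENNReal.ofReal_mul (by positivity),
    Real.sqrt_mul_self_eq_abs]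

theorem measurable_mulVec {ι κ : Type*} [Fintype ι] (K : Matrix κ ι ℝ) :
    Measurable fun z => K *ᵥ z := by
  unfold mulVec dotProduct
  fun_prop

variable {ι κ : Type*} [Fintype ι] [Fintype κ] [DecidableEq κ]

/-- The orthogonal projection to the row space of a matrix of full row rank. -/
def rowProj (K : Matrix κ ι ℝ) : Matrix ι ι ℝ := Kᵀ * (K * Kᵀ)⁻¹ * K

/-- The factor in the coarea formula for a Gaussian integral. -/
def fiberConst (K : Matrix κ ι ℝ) : ℝ :=
  √(2 * Real.pi) ^ Fintype.card ι / (√(2 * Real.pi) ^ Fintype.card κ * √(K * Kᵀ).det)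

/-- Pythagoras for the kernel and row space components; the squared length of the latter depends
only on `K z`. -/
theorem dotProduct_self_eq_rowProj {K : Matrix κ ι ℝ} (hK : (K * Kᵀ).PosDef) (z : ι → ℝ) :
    z ⬝ᵥ z = (z - rowProj K *ᵥ z) ⬝ᵥ (z - rowProj K *ᵥ z) +
      ((K * Kᵀ)⁻¹ *ᵥ (K *ᵥ z)) ⬝ᵥ (K *ᵥ z) := by
  set x := (K * Kᵀ)⁻¹ *ᵥ (K *ᵥ z) with hx
  have hu : IsUnit (K * Kᵀ).det := hK.det_pos.ne'.isUnit
  have hP : rowProj K *ᵥ z = Kᵀ *ᵥ x := by simp [rowProj, hx, mulVec_mulVec, Matrix.mul_assoc]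
  have hGx : (K * Kᵀ) *ᵥ x = K *ᵥ z := by
    rw [hx, mulVec_mulVec, mul_nonsing_inv _ hu, one_mulVec]
  have h1 : z ⬝ᵥ (Kᵀ *ᵥ x) = x ⬝ᵥ (K *ᵥ z) := by
    rw [dotProduct_mulVec, vecMul_transpose, dotProduct_comm]
  have h2 : (Kᵀ *ᵥ x) ⬝ᵥ (Kᵀ *ᵥ x) = x ⬝ᵥ (K *ᵥ z) := by
    rw [dotProduct_mulVec, vecMul_transpose, mulVec_mulVec, hGx, dotProduct_comm]
  have h3 : (Kᵀ *ᵥ x) ⬝ᵥ z = x ⬝ᵥ (K *ᵥ z) := by rw [dotProduct_comm, h1]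
  rw [hP]
  simp only [sub_dotProduct, dotProduct_sub, h1, h2, h3]
  ring

theorem mulVec_rowProj {K : Matrix κ ι ℝ} (hK : (K * Kᵀ).PosDef) (z : ι → ℝ) :
    K *ᵥ (rowProj K *ᵥ z) = K *ᵥ z := by
  rw [rowProj, mulVec_mulVec, Matrix.mul_assoc, ← Matrix.mul_assoc K, ← Matrix.mul_assoc,
    mul_nonsing_inv _ hK.det_pos.ne'.isUnit, Matrix.one_mul]

/-- The measure with density `exp (-|u|²/2)`, `u` the component of a vector in the kernel of `K`,
is mapped by `K` to a multiple of the Lebesgue measure. -/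
theorem lintegral_exp_rowProj_mul_comp {K : Matrix κ ι ℝ} (hK : (K * Kᵀ).PosDef)
    {h : (κ → ℝ) → ℝ≥0∞} (hh : Measurable h) :
    ∫⁻ z, ENNReal.ofReal (Real.exp (-(1 / 2) *
      ((z - rowProj K *ᵥ z) ⬝ᵥ (z - rowProj K *ᵥ z)))) * h (K *ᵥ z) =
      ENNReal.ofReal (fiberConst K) * ∫⁻ y, h y := by
  have hu : IsUnit (K * Kᵀ).det := hK.det_pos.ne'.isUnit
  set w : (ι → ℝ) → ℝ≥0∞ := fun z => ENNReal.ofReal (Real.exp (-(1 / 2) *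
      ((z - rowProj K *ᵥ z) ⬝ᵥ (z - rowProj K *ᵥ z)))) with hw
  have hwm : Measurable w := by
    simp only [hw]
    unfold mulVec dotProduct
    fun_prop
  have hKm := measurable_mulVec K
  -- Instead of choosing a basis adapted to the kernel, `ν` is shown to be translation invariant and
  -- finite on compact sets, hence a multiple of Lebesgue measure. The multiple is found by testing
  -- against the Gaussian `q`.
  set ν : Measure (κ → ℝ) := (volume.withDensity w).map (fun z => K *ᵥ z) with hν
  have hνint : ∀ h : (κ → ℝ) → ℝ≥0∞, Measurable h → ∫⁻ y, h y ∂ν = ∫⁻ z, w z * h (K *ᵥ z) := by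
    intro h hh
    rw [hν, lintegral_map hh hKm, lintegral_withDensity_eq_lintegral_mul (g := fun z => h (K *ᵥ z))
      _ hwm (hh.comp hKm)]
    rfl
  set q : (κ → ℝ) → ℝ := fun y => Real.exp (-(1 / 2) * (((K * Kᵀ)⁻¹ *ᵥ y) ⬝ᵥ y)) with hq
  have hqc : Continuous q := by
    simp only [hq]
    unfold mulVec dotProduct
    fun_prop
  have hqint : ∫⁻ y, ENNReal.ofReal (q y) ∂ν =
      ENNReal.ofReal (√(2 * Real.pi) ^ Fintype.card ι) := by
    rw [hνint _ (by fun_prop), ← lintegral_exp_neg_half_dotProduct ι]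
    refine lintegral_congr fun z => ?_
    rw [hw, hq, ← ENNReal.ofReal_mul (Real.exp_pos _).le, ← Real.exp_add, ← mul_add,
      ← dotProduct_self_eq_rowProj hK]
  have hinv : ν.IsAddLeftInvariant := by
    refine ⟨fun y => ?_⟩
    ext s hs
    rw [Measure.map_apply (measurable_const_add y) hs,
      ← lintegral_indicator_one ((measurable_const_add y) hs), ← lintegral_indicator_one hs,
      hνint _ (measurable_one.indicator ((measurable_const_add y) hs)),
      hνint _ (measurable_one.indicator hs)]
    have hz : K *ᵥ (Kᵀ *ᵥ ((K * Kᵀ)⁻¹ *ᵥ y)) = y := by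
      rw [mulVec_mulVec, mulVec_mulVec, mul_nonsing_inv _ hu, one_mulVec]
    -- The lift of `y` to the row space: translation by it leaves the kernel component, and so the
    -- weight `w`, unchanged.
    set z₀ := Kᵀ *ᵥ ((K * Kᵀ)⁻¹ *ᵥ y) with hz₀
    have hPz : rowProj K *ᵥ z₀ = z₀ := by
      rw [rowProj, ← mulVec_mulVec, hz, ← mulVec_mulVec]
    rw [← lintegral_add_right_eq_self (fun z => w z * s.indicator 1 (K *ᵥ z)) z₀]
    refine lintegral_congr fun z => ?_
    have h1 : w (z + z₀) = w z := by
      simp only [hw, mulVec_add, hPz, add_sub_add_right_eq_sub]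
    rw [h1, mulVec_add, hz, add_comm (K *ᵥ z)]
    rfl
  have hfin : IsFiniteMeasureOnCompacts ν := by
    refine ⟨fun B hB => ?_⟩
    rcases B.eq_empty_or_nonempty with rfl | hne
    · simp
    obtain ⟨y₀, hy₀, hmin⟩ := hB.exists_isMinOn hne hqc.continuousOn
    -- Markov's inequality, with the positive minimum of `q` on the compact set.
    have h1 : ENNReal.ofReal (q y₀) * ν B ≤ ∫⁻ y, ENNReal.ofReal (q y) ∂ν := by
      rw [← setLIntegral_const]
      exact (setLIntegral_mono (by fun_prop)
        fun y hy => ENNReal.ofReal_le_ofReal (hmin hy)).trans (setLIntegral_le_lintegral _ _)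
    rw [hqint] at h1
    have h2 : ENNReal.ofReal (q y₀) ≠ 0 := by simpa using Real.exp_pos _
    by_contra htop
    rw [not_lt, top_le_iff] at htop
    rw [htop, ENNReal.mul_top h2, top_le_iff] at h1
    exact ENNReal.ofReal_ne_top h1
  have hsmul := Measure.isAddLeftInvariant_eq_smul ν volume
  set c := Measure.addHaarScalarFactor ν volume
  have hQ := lintegral_exp_neg_half_quadratic hK.inv
  have hc : (c : ℝ≥0∞) = ENNReal.ofReal (fiberConst K) := by
    rw [hsmul, lintegral_smul_measure, hQ, ENNReal.smul_def, smul_eq_mul] at hqint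
    have hpos : 0 < (√(K * Kᵀ)⁻¹.det)⁻¹ * √(2 * Real.pi) ^ Fintype.card κ :=
      mul_pos (inv_pos.2 (Real.sqrt_pos.2 hK.inv.det_pos)) (by positivity)
    rw [(ENNReal.eq_div_iff (ENNReal.ofReal_pos.2 hpos).ne' ENNReal.ofReal_ne_top).2 ((mul_comm _ _).trans hqint),
      ← ENNReal.ofReal_div_of_pos hpos, fiberConst]
    congr 2
    rw [det_nonsing_inv, Ring.inverse_eq_inv', Real.sqrt_inv, inv_inv, mul_comm]
  rw [← hνint h hh, hsmul, lintegral_smul_measure, ← hc]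
  rfl

/-- The image of a standard Gaussian measure by a linear surjection. -/
theorem lintegral_exp_mul_comp_mulVec {K : Matrix κ ι ℝ} (hK : (K * Kᵀ).PosDef)
    {h : (κ → ℝ) → ℝ≥0∞} (hh : Measurable h) :
    ∫⁻ z, ENNReal.ofReal (Real.exp (-(1 / 2) * (z ⬝ᵥ z))) * h (K *ᵥ z) =
      ENNReal.ofReal (fiberConst K) *
        ∫⁻ y, ENNReal.ofReal (Real.exp (-(1 / 2) * (((K * Kᵀ)⁻¹ *ᵥ y) ⬝ᵥ y))) * h y := by
  rw [← lintegral_exp_rowProj_mul_comp hK (h := fun y => ENNReal.ofReal (Real.exp (-(1 / 2) *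
    (((K * Kᵀ)⁻¹ *ᵥ y) ⬝ᵥ y))) * h y) (by
      have : Continuous fun y : κ → ℝ => ((K * Kᵀ)⁻¹ *ᵥ y) ⬝ᵥ y := by
        unfold mulVec dotProduct; fun_prop
      have := this.measurable
      fun_prop)]
  refine lintegral_congr fun z => ?_
  rw [← mul_assoc, ← ENNReal.ofReal_mul (Real.exp_pos _).le, ← Real.exp_add, ← mul_add,
      ← dotProduct_self_eq_rowProj hK]

end GaussianFiber

/-! ### The map `twist`, its Jacobian and its mean multiplicity. -/

section Twist

open Matrix

variable {ι κ : Type*} [Fintype ι] [Fintype κ] [DecidableEq κ]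

/-- Blockwise rotation of the vector formed by `w ∘ inl` and the component of `w ∘ inr` in the
kernel of `A`, the angles being the row space component of `w ∘ inr`. -/
def twist (A : Matrix κ ι ℝ) (w : ι ⊕ ι → ℝ) : ι ⊕ ι → ℝ :=
  let φ := rowProj A *ᵥ (w ∘ Sum.inr)
  Sum.elim
    (fun i => Real.cos (φ i) * w (Sum.inl i) - Real.sin (φ i) * (w (Sum.inr i) - φ i))
    (fun i => Real.sin (φ i) * w (Sum.inl i) + Real.cos (φ i) * (w (Sum.inr i) - φ i))

/-- Rotations preserve length. The row space component of `w ∘ inr` serves only as an angle and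
drops out, which is why the Gaussian weight later factors. -/
theorem dotProduct_self_twist (A : Matrix κ ι ℝ) (w : ι ⊕ ι → ℝ) :
    twist A w ⬝ᵥ twist A w = (w ∘ Sum.inl) ⬝ᵥ (w ∘ Sum.inl) +
      (w ∘ Sum.inr - rowProj A *ᵥ (w ∘ Sum.inr)) ⬝ᵥ
        (w ∘ Sum.inr - rowProj A *ᵥ (w ∘ Sum.inr)) := by
  simp only [dotProduct, Fintype.sum_sum_type, twist, Sum.elim_inl, Sum.elim_inr,
    ← Finset.sum_add_distrib]
  refine Finset.sum_congr rfl fun i _ => ?_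
  have := Real.sin_sq_add_cos_sq ((rowProj A *ᵥ (w ∘ Sum.inr)) i)
  set s := Real.sin ((rowProj A *ᵥ (w ∘ Sum.inr)) i)
  set c := Real.cos ((rowProj A *ᵥ (w ∘ Sum.inr)) i)
  simp only [Pi.sub_apply, Function.comp_apply]
  linear_combination (w (Sum.inl i) ^ 2 +
    (w (Sum.inr i) - (rowProj A *ᵥ (w ∘ Sum.inr)) i) ^ 2) * this

/-- A fundamental domain for the angles of `twist A`. -/
def twistDomain (A : Matrix κ ι ℝ) : Set (ι ⊕ ι → ℝ) :=
  {w | (A * Aᵀ)⁻¹ *ᵥ (A *ᵥ (w ∘ Sum.inr)) ∈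
    Set.univ.pi fun _ : κ => Set.Ico (0 : ℝ) (2 * Real.pi)}

theorem lintegral_sum_elim_mul {ι : Type*} [Fintype ι] {f g : (ι → ℝ) → ℝ≥0∞} (hf : Measurable f) (hg : Measurable g) :
    ∫⁻ w : ι ⊕ ι → ℝ, f (w ∘ Sum.inl) * g (w ∘ Sum.inr) = (∫⁻ a, f a) * ∫⁻ z, g z := by
  rw [← lintegral_prod_mul hf.aemeasurable hg.aemeasurable]
  exact (volume_measurePreserving_sumPiEquivProdPi fun _ : ι ⊕ ι => ℝ).lintegral_comp_emb
    (MeasurableEquiv.measurableEmbedding _) (fun p => f p.1 * g p.2)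

variable [DecidableEq ι]

/-- The matrix of the rotations by the angles `φ`. -/
def rotMatrix {ι : Type*} [DecidableEq ι] (φ : ι → ℝ) : Matrix (ι ⊕ ι) (ι ⊕ ι) ℝ :=
  fromBlocks (diagonal fun i => Real.cos (φ i)) (-diagonal fun i => Real.sin (φ i))
    (diagonal fun i => Real.sin (φ i)) (diagonal fun i => Real.cos (φ i))

theorem abs_det_rotMatrix (φ : ι → ℝ) : |(rotMatrix φ).det| = 1 := by
  have h : (rotMatrix φ)ᵀ * rotMatrix φ = 1 := by
    simp only [rotMatrix, fromBlocks_transpose, fromBlocks_multiply, diagonal_transpose,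
      diagonal_mul_diagonal, diagonal_add, diagonal_neg]
    rw [← fromBlocks_one, ← diagonal_one]
    congr 1
    · congr 1; funext i; linear_combination Real.sin_sq_add_cos_sq (φ i)
    · rw [← diagonal_zero]; congr 1; funext i; ring
    · rw [← diagonal_zero]; congr 1; funext i; ring
    · congr 1; funext i; linear_combination Real.sin_sq_add_cos_sq (φ i)
  have h2 := congrArg Matrix.det h
  rw [det_mul, det_transpose, det_one] at h2
  rcases mul_self_eq_one_iff.1 h2 with h3 | h3 <;> simp [h3]

/-- The Jacobian matrix of `twist A`. -/
def twistDeriv (A : Matrix κ ι ℝ) (w : ι ⊕ ι → ℝ) : Matrix (ι ⊕ ι) (ι ⊕ ι) ℝ :=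
  let φ := rowProj A *ᵥ (w ∘ Sum.inr)
  rotMatrix φ *
    fromBlocks 1 (-(diagonal (w ∘ Sum.inr - φ) * rowProj A)) 0
      (1 - rowProj A + diagonal (w ∘ Sum.inl) * rowProj A)

/-- With `a = w ∘ inl`, `u = w ∘ inr - φ` and `R(φ)` the rotation, `d (R(φ)(a, u)) = R(φ)(da - u dφ,
du + a dφ)`. Here `dφ = P dz` and `du = (1 - P) dz`, where `z = w ∘ inr` and `P = rowProj A`. -/
theorem hasFDerivAt_twist (A : Matrix κ ι ℝ) (w : ι ⊕ ι → ℝ) :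
    HasFDerivAt (twist A) (LinearMap.toContinuousLinearMap (toLin' (twistDeriv A w))) w := by
  rw [hasFDerivAt_pi']
  have hp : ∀ k : ι ⊕ ι, HasFDerivAt (fun w : ι ⊕ ι → ℝ => w k)
      (ContinuousLinearMap.proj (R := ℝ) (φ := fun _ : ι ⊕ ι => ℝ) k) w := fun k =>
    (ContinuousLinearMap.proj (R := ℝ) (φ := fun _ : ι ⊕ ι => ℝ) k).hasFDerivAt
  have hφ : ∀ i, HasFDerivAt (fun w : ι ⊕ ι → ℝ => (rowProj A *ᵥ (w ∘ Sum.inr)) i)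
      (∑ j, rowProj A i j • ContinuousLinearMap.proj (R := ℝ) (φ := fun _ : ι ⊕ ι => ℝ)
        (Sum.inr j)) w := fun i => by
    simp only [mulVec, dotProduct]
    exact HasFDerivAt.fun_sum fun j _ => (hp (Sum.inr j)).const_mul _
  have happ : ∀ (v : ι ⊕ ι → ℝ) (i : ι), (∑ j, rowProj A i j •
      ContinuousLinearMap.proj (R := ℝ) (φ := fun _ : ι ⊕ ι => ℝ) (Sum.inr j)) v =
        (rowProj A *ᵥ (v ∘ Sum.inr)) i := fun v i => by
    simp [mulVec, dotProduct]
  have hmat : ∀ v, twistDeriv A w *ᵥ v = rotMatrix (rowProj A *ᵥ (w ∘ Sum.inr)) *ᵥ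
      Sum.elim (v ∘ Sum.inl - (w ∘ Sum.inr - rowProj A *ᵥ (w ∘ Sum.inr)) *
          (rowProj A *ᵥ (v ∘ Sum.inr)))
        (v ∘ Sum.inr - rowProj A *ᵥ (v ∘ Sum.inr) +
          w ∘ Sum.inl * (rowProj A *ᵥ (v ∘ Sum.inr))) := fun v => by
    rw [twistDeriv, ← mulVec_mulVec, fromBlocks_mulVec]
    congr 2
    · rw [one_mulVec, neg_mulVec, ← mulVec_mulVec, sub_eq_add_neg]
      congr 2
      ext i
      rw [mulVec_diagonal]
      rfl
    · rw [zero_mulVec, zero_add, add_mulVec, sub_mulVec, one_mulVec, ← mulVec_mulVec]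
      congr 1
      ext i
      rw [mulVec_diagonal]
      rfl
  rintro (i | i)
  · refine ((((hφ i).cos.mul (hp (Sum.inl i))).sub
      ((hφ i).sin.mul ((hp (Sum.inr i)).sub (hφ i))))).congr_fderiv ?_
    ext1 v
    simp only [ContinuousLinearMap.comp_apply, ContinuousLinearMap.proj_apply,
      LinearMap.coe_toContinuousLinearMap', toLin'_apply, hmat]
    simp only [rotMatrix, fromBlocks_mulVec, Sum.elim_inl, Sum.elim_comp_inl, Sum.elim_comp_inr,
      Pi.add_apply, neg_mulVec, mulVec_diagonal, Pi.neg_apply, Pi.sub_apply, Pi.mul_apply,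
      Function.comp_apply, _root_.sub_apply, _root_.add_apply,
      _root_.smul_apply, smul_eq_mul, happ, ContinuousLinearMap.proj_apply]
    ring
  · refine ((((hφ i).sin.mul (hp (Sum.inl i))).add
      ((hφ i).cos.mul ((hp (Sum.inr i)).sub (hφ i))))).congr_fderiv ?_
    ext1 v
    simp only [ContinuousLinearMap.comp_apply, ContinuousLinearMap.proj_apply,
      LinearMap.coe_toContinuousLinearMap', toLin'_apply, hmat]
    simp only [rotMatrix, fromBlocks_mulVec, Sum.elim_inr, Sum.elim_comp_inl, Sum.elim_comp_inr,
      Pi.add_apply, mulVec_diagonal, Pi.sub_apply, Pi.mul_apply,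
      Function.comp_apply, _root_.sub_apply, _root_.add_apply,
      _root_.smul_apply, smul_eq_mul, happ, ContinuousLinearMap.proj_apply]
    ring

/-- Up to a rotation the Jacobian matrix is block triangular with lower block `1 + (D - 1) P`, `P =
Aᵀ (A Aᵀ)⁻¹ A`. Sylvester's identity `det (1 + X A) = det (1 + A X)` reduces it to the small matrix
`A D Aᵀ (A Aᵀ)⁻¹`. -/
theorem abs_det_twistDeriv {A : Matrix κ ι ℝ} (hA : (A * Aᵀ).PosDef) (w : ι ⊕ ι → ℝ) :
    |(twistDeriv A w).det| = |(A * diagonal (w ∘ Sum.inl) * Aᵀ).det| * (A * Aᵀ).det⁻¹ := by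
  have hu : IsUnit (A * Aᵀ).det := hA.det_pos.ne'.isUnit
  set D := diagonal (w ∘ Sum.inl)
  have h1 : 1 - rowProj A + D * rowProj A = 1 + ((D - 1) * (Aᵀ * (A * Aᵀ)⁻¹)) * A := by
    rw [Matrix.mul_assoc, ← rowProj, Matrix.sub_mul, Matrix.one_mul]
    abel
  have h2 : 1 + A * ((D - 1) * (Aᵀ * (A * Aᵀ)⁻¹)) = A * D * Aᵀ * (A * Aᵀ)⁻¹ := by
    have : A * Aᵀ * (A * Aᵀ)⁻¹ = 1 := mul_nonsing_inv _ hu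
    rw [Matrix.sub_mul, Matrix.mul_sub, Matrix.one_mul, ← Matrix.mul_assoc A Aᵀ, this]
    simp only [Matrix.mul_assoc]
    abel
  rw [twistDeriv, det_mul, abs_mul, abs_det_rotMatrix, one_mul, det_fromBlocks_zero₂₁, det_one,
    one_mul, h1, det_one_add_mul_comm, h2, det_mul, abs_mul, det_nonsing_inv,
    Ring.inverse_eq_inv', abs_of_pos (inv_pos.2 hA.det_pos)]

/-- The Gaussian average of the number of points in a fiber of `twist A`. -/
theorem lintegral_encard_twist {A : Matrix κ ι ℝ} (hA : (A * Aᵀ).PosDef) :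
    AEMeasurable (fun y => ((twistDomain A ∩ twist A ⁻¹' {y}).encard : ℝ≥0∞)) ∧
    ∫⁻ y, ((twistDomain A ∩ twist A ⁻¹' {y}).encard : ℝ≥0∞) *
        ENNReal.ofReal (Real.exp (-(1 / 2) * (y ⬝ᵥ y))) =
      ENNReal.ofReal (fiberConst A * (2 * Real.pi) ^ Fintype.card κ) *
        ∫⁻ a : ι → ℝ, ENNReal.ofReal (Real.exp (-(1 / 2) * (a ⬝ᵥ a))) *
          ENNReal.ofReal |(A * diagonal a * Aᵀ).det| := by
  have hu : IsUnit (A * Aᵀ).det := hA.det_pos.ne'.isUnit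
  have hd := hA.det_pos
  set Q : Set (κ → ℝ) := Set.univ.pi fun _ : κ => Set.Ico (0 : ℝ) (2 * Real.pi) with hQ
  have hQm : MeasurableSet Q := MeasurableSet.univ_pi fun _ => measurableSet_Ico
  have hS : Measurable fun z : ι → ℝ => (A * Aᵀ)⁻¹ *ᵥ (A *ᵥ z) :=
    (measurable_mulVec _).comp (measurable_mulVec A)
  have hr : Measurable fun w : ι ⊕ ι → ℝ => w ∘ Sum.inr := by
    refine measurable_pi_lambda _ fun i => measurable_pi_apply _
  have hs : MeasurableSet (twistDomain A) := hS.comp hr hQm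
  have hdetm : Measurable fun a : ι → ℝ => (A * diagonal a * Aᵀ).det := by
    refine Continuous.measurable ?_
    fun_prop
  have hdetw : Measurable fun w => (LinearMap.toContinuousLinearMap
      (toLin' (twistDeriv A w))).det := by
    refine Continuous.measurable ?_
    simp only [LinearMap.det_toContinuousLinearMap, LinearMap.det_toLin']
    unfold twistDeriv rotMatrix
    fun_prop
  have hdot : ∀ {τ : Type _} [Fintype τ], Measurable fun y : τ → ℝ =>
      ENNReal.ofReal (Real.exp (-(1 / 2) * (y ⬝ᵥ y))) := by
    intro τ _
    unfold dotProduct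
    fun_prop
  obtain ⟨h1, h2⟩ := lintegral_encard_fiber volume hs
    (fun w _ => (hasFDerivAt_twist A w).hasFDerivWithinAt) hdetw
    (g := fun y => ENNReal.ofReal (Real.exp (-(1 / 2) * (y ⬝ᵥ y)))) hdot
  refine ⟨h1, h2.trans ?_⟩
  simp only [LinearMap.det_toContinuousLinearMap, LinearMap.det_toLin', abs_det_twistDeriv hA,
    dotProduct_self_twist]
  rw [← lintegral_indicator hs]
  have hsplit : ∀ w : ι ⊕ ι → ℝ, (twistDomain A).indicator (fun w =>
      ENNReal.ofReal (|(A * diagonal (w ∘ Sum.inl) * Aᵀ).det| * (A * Aᵀ).det⁻¹) *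
        ENNReal.ofReal (Real.exp (-(1 / 2) * ((w ∘ Sum.inl) ⬝ᵥ (w ∘ Sum.inl) +
          (w ∘ Sum.inr - rowProj A *ᵥ (w ∘ Sum.inr)) ⬝ᵥ
            (w ∘ Sum.inr - rowProj A *ᵥ (w ∘ Sum.inr)))))) w =
      (fun a : ι → ℝ => ENNReal.ofReal (A * Aᵀ).det⁻¹ * (ENNReal.ofReal (Real.exp (-(1 / 2) * (a ⬝ᵥ a))) *
          ENNReal.ofReal |(A * diagonal a * Aᵀ).det|)) (w ∘ Sum.inl) *
        (fun z => ENNReal.ofReal (Real.exp (-(1 / 2) *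
          ((z - rowProj A *ᵥ z) ⬝ᵥ (z - rowProj A *ᵥ z)))) *
            Q.indicator 1 ((A * Aᵀ)⁻¹ *ᵥ (A *ᵥ z))) (w ∘ Sum.inr) := by
    intro w
    by_cases hw : w ∈ twistDomain A
    · have hw' : (A * Aᵀ)⁻¹ *ᵥ (A *ᵥ (w ∘ Sum.inr)) ∈ Q := hw
      simp only [Set.indicator_of_mem hw, Set.indicator_of_mem hw']
      rw [mul_add, Real.exp_add, ENNReal.ofReal_mul (abs_nonneg _),
        ENNReal.ofReal_mul (Real.exp_pos _).le, Pi.one_apply, mul_one]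
      ring
    · have hw' : (A * Aᵀ)⁻¹ *ᵥ (A *ᵥ (w ∘ Sum.inr)) ∉ Q := hw
      simp only [Set.indicator_of_notMem hw, Set.indicator_of_notMem hw', mul_zero]
  have hind : Measurable (Q.indicator (1 : (κ → ℝ) → ℝ≥0∞)) := measurable_one.indicator hQm
  have hF : Measurable fun a : ι → ℝ => ENNReal.ofReal (Real.exp (-(1 / 2) * (a ⬝ᵥ a))) *
      ENNReal.ofReal |(A * diagonal a * Aᵀ).det| :=
    hdot.mul (ENNReal.measurable_ofReal.comp hdetm.abs)
  have hcF : Measurable fun a : ι → ℝ => ENNReal.ofReal (A * Aᵀ).det⁻¹ *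
      (ENNReal.ofReal (Real.exp (-(1 / 2) * (a ⬝ᵥ a))) *
        ENNReal.ofReal |(A * diagonal a * Aᵀ).det|) := hF.const_mul _
  have hG : Measurable fun z : ι → ℝ => ENNReal.ofReal (Real.exp (-(1 / 2) *
      ((z - rowProj A *ᵥ z) ⬝ᵥ (z - rowProj A *ᵥ z)))) *
        Q.indicator 1 ((A * Aᵀ)⁻¹ *ᵥ (A *ᵥ z)) := by
    refine Measurable.mul ?_ (hind.comp hS)
    unfold mulVec dotProduct
    fun_prop
  -- The indicator depends on `z` only through `A z`, so the kernel part integrates to `fiberConst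
  -- A`. Passing to the coordinates `(A Aᵀ)⁻¹ y` costs a factor `det (A Aᵀ)`, which cancels the
  -- inverse one in the Jacobian; the box remains.
  rw [lintegral_congr hsplit, lintegral_sum_elim_mul hcF hG,
    lintegral_exp_rowProj_mul_comp hA (h := fun y => Q.indicator 1 ((A * Aᵀ)⁻¹ *ᵥ y))
      (hind.comp (measurable_mulVec _)),
    lintegral_comp_mulVec (B := (A * Aᵀ)⁻¹) hA.inv.det_pos.ne' hind,
    lintegral_indicator_one hQm]
  have hvol : volume Q = ENNReal.ofReal ((2 * Real.pi) ^ Fintype.card κ) := by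
    rw [hQ, volume_pi_pi]
    simp [ENNReal.ofReal_pow Real.two_pi_pos.le]
  rw [hvol, lintegral_const_mul _ hF,
    det_nonsing_inv, Ring.inverse_eq_inv', abs_of_pos (inv_pos.2 hd), inv_inv]
  rw [ENNReal.ofReal_mul (p := fiberConst A) (by unfold fiberConst; positivity)]
  have hcancel : ENNReal.ofReal (A * Aᵀ).det⁻¹ * ENNReal.ofReal (A * Aᵀ).det = 1 := by
    rw [← ENNReal.ofReal_mul (inv_pos.2 hd).le, inv_mul_cancel₀ hd.ne', ENNReal.ofReal_one]
  generalize (∫⁻ a : ι → ℝ, ENNReal.ofReal (Real.exp (-(1 / 2) * (a ⬝ᵥ a))) *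
          ENNReal.ofReal |(A * diagonal a * Aᵀ).det|) = I
  calc _ = ENNReal.ofReal (A * Aᵀ).det⁻¹ * ENNReal.ofReal (A * Aᵀ).det *
      (ENNReal.ofReal (fiberConst A) * ENNReal.ofReal ((2 * Real.pi) ^ Fintype.card κ) * I) := by
        ring
    _ = _ := by rw [hcancel, one_mul]

end Twist

section Torus

/-! ### Integrals of trigonometric functions on the torus -/

theorem circleCos_coe (x : ℝ) : circleCos (x : AddCircle (2 * Real.pi)) = Real.cos x := rfl

theorem circleSin_coe (x : ℝ) : circleSin (x : AddCircle (2 * Real.pi)) = Real.sin x := rfl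

theorem circleCos_add_pi (a : AddCircle (2 * Real.pi)) :
    circleCos (a + (Real.pi : ℝ)) = -circleCos a := by
  induction a using QuotientAddGroup.induction_on with
  | H x => exact Real.cos_add_pi x

theorem circleSin_add_pi (a : AddCircle (2 * Real.pi)) :
    circleSin (a + (Real.pi : ℝ)) = -circleSin a := by
  induction a using QuotientAddGroup.induction_on with
  | H x => exact Real.sin_add_pi x

theorem circleCos_mul_circleCos (a b : AddCircle (2 * Real.pi)) :
    circleCos a * circleCos b = 1 / 2 * (circleCos (a - b) + circleCos (a + b)) := by
  induction a using QuotientAddGroup.induction_on with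
  | H x =>
    induction b using QuotientAddGroup.induction_on with
    | H y =>
      change Real.cos x * Real.cos y = 1 / 2 * (Real.cos (x - y) + Real.cos (x + y))
      rw [Real.cos_sub, Real.cos_add]
      ring

theorem circleSin_mul_circleSin (a b : AddCircle (2 * Real.pi)) :
    circleSin a * circleSin b = 1 / 2 * (circleCos (a - b) - circleCos (a + b)) := by
  induction a using QuotientAddGroup.induction_on with
  | H x =>
    induction b using QuotientAddGroup.induction_on with
    | H y =>
      change Real.sin x * Real.sin y = 1 / 2 * (Real.cos (x - y) - Real.cos (x + y))
      rw [Real.cos_sub, Real.cos_add]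
      ring

theorem circleSin_mul_circleCos (a b : AddCircle (2 * Real.pi)) :
    circleSin a * circleCos b = 1 / 2 * (circleSin (a - b) + circleSin (a + b)) := by
  induction a using QuotientAddGroup.induction_on with
  | H x =>
    induction b using QuotientAddGroup.induction_on with
    | H y =>
      change Real.sin x * Real.cos y = 1 / 2 * (Real.sin (x - y) + Real.sin (x + y))
      rw [Real.sin_sub, Real.sin_add]
      ring

variable {L : ℕ}

/-- The angle `m₁θ₁ + ⋯ + m_Lθ_L`. -/
def phase (m : Fin L → ℤ) (θ : Torus L) : AddCircle (2 * Real.pi) := ∑ j, m j • θ j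

theorem continuous_phase (m : Fin L → ℤ) : Continuous (phase m) := by
  unfold phase
  fun_prop

theorem phase_add_right (m : Fin L → ℤ) (θ η : Torus L) :
    phase m (θ + η) = phase m θ + phase m η := by
  simp [phase, smul_add, Finset.sum_add_distrib]

theorem phase_add_left (m n : Fin L → ℤ) (θ : Torus L) :
    phase (m + n) θ = phase m θ + phase n θ := by
  simp [phase, add_smul, Finset.sum_add_distrib]

theorem phase_sub_left (m n : Fin L → ℤ) (θ : Torus L) :
    phase (m - n) θ = phase m θ - phase n θ := by
  simp [phase, sub_smul, Finset.sum_sub_distrib]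

theorem exists_phase_eq_pi {m : Fin L → ℤ} (hm : m ≠ 0) : ∃ η, phase m η = (Real.pi : ℝ) := by
  obtain ⟨i, hi⟩ := Function.ne_iff.1 hm
  have hi' : (m i : ℝ) ≠ 0 := by exact_mod_cast hi
  refine ⟨Pi.single i ((Real.pi / m i : ℝ) : AddCircle (2 * Real.pi)), ?_⟩
  rw [phase, Finset.sum_eq_single i (fun j _ hj => by simp [hj]) (by simp), Pi.single_eq_same,
    ← AddCircle.coe_zsmul, zsmul_eq_mul, mul_div_cancel₀ _ hi']

/-- Translating the torus by a point of phase `π` preserves the integral and flips its sign. -/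
theorem integral_eq_zero_of_add_pi {f : AddCircle (2 * Real.pi) → ℝ}
    (hf : ∀ a, f (a + (Real.pi : ℝ)) = -f a) {m : Fin L → ℤ} (hm : m ≠ 0) :
    ∫ θ : Torus L, f (phase m θ) = 0 := by
  obtain ⟨η, hη⟩ := exists_phase_eq_pi hm
  have h := integral_add_right_eq_self (μ := (volume : Measure (Torus L)))
    (fun θ => f (phase m θ)) η
  simp only [phase_add_right, hη, hf, integral_neg] at h
  linarith

theorem integral_circleSin_phase (m : Fin L → ℤ) : ∫ θ : Torus L, circleSin (phase m θ) = 0 := by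
  by_cases hm : m = 0
  · subst hm
    have : circleSin 0 = 0 := Real.sin_zero
    simp [phase, this]
  · exact integral_eq_zero_of_add_pi circleSin_add_pi hm

theorem integral_circleCos_phase (m : Fin L → ℤ) :
    ∫ θ : Torus L, circleCos (phase m θ) = if m = 0 then (2 * Real.pi) ^ L else 0 := by
  split_ifs with hm
  · subst hm
    have : circleCos 0 = 1 := Real.cos_zero
    have hv : (volume : Measure (Torus L)) Set.univ = ENNReal.ofReal ((2 * Real.pi) ^ L) := by
      rw [volume_pi, Measure.pi_univ]
      simp [AddCircle.measure_univ, ENNReal.ofReal_pow Real.two_pi_pos.le]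
    simp [phase, this, Measure.real, hv, Real.pi_pos.le]
  · exact integral_eq_zero_of_add_pi circleCos_add_pi hm

theorem integrable_circleCos_phase (m : Fin L → ℤ) :
    Integrable fun θ : Torus L => circleCos (phase m θ) :=
  (continuous_circleCos.comp (continuous_phase m)).integrable_of_hasCompactSupport
    (HasCompactSupport.of_compactSpace _)

theorem integrable_circleSin_phase (m : Fin L → ℤ) :
    Integrable fun θ : Torus L => circleSin (phase m θ) :=
  (continuous_circleSin.comp (continuous_phase m)).integrable_of_hasCompactSupport
    (HasCompactSupport.of_compactSpace _)

/-- The common value of the factors `p(m)`, `m ≠ 0`. -/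
def trigScale (L : ℕ) : ℝ := √2 / (2 * Real.pi) ^ ((L : ℝ) / 2)

theorem trigScale_pos (L : ℕ) : 0 < trigScale L := by
  unfold trigScale
  positivity

theorem trigScale_sq (L : ℕ) : trigScale L ^ 2 = 2 / (2 * Real.pi) ^ L := by
  rw [trigScale, div_pow, Real.sq_sqrt zero_le_two, ← Real.rpow_natCast, ← Real.rpow_mul
    Real.two_pi_pos.le, ← Real.rpow_natCast]
  congr 2
  push_cast
  ring

theorem normFactor_of_mem {m : Fin L → ℤ} (hm : m ∈ posCone L) : normFactor m = trigScale L := by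
  rw [normFactor, if_neg (posCone_ne_zero hm), trigScale]

theorem cosFun_apply {m : Fin L → ℤ} (hm : m ∈ posCone L) (θ : Torus L) :
    cosFun m θ = trigScale L * circleCos (phase m θ) := by
  rw [← normFactor_of_mem hm]
  rfl

theorem sinFun_apply {m : Fin L → ℤ} (hm : m ∈ posCone L) (θ : Torus L) :
    sinFun m θ = trigScale L * circleSin (phase m θ) := by
  rw [← normFactor_of_mem hm]
  rfl

/-- The purpose of the cone: the mode `m + n` in the product-to-sum formulas never contributes to an
inner product. -/
theorem posCone_add_ne_zero {m n : Fin L → ℤ} (hm : m ∈ posCone L) (hn : n ∈ posCone L) :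
    m + n ≠ 0 := fun h => posCone_not_neg hm (by rwa [neg_eq_of_add_eq_zero_right h])

theorem trigScale_sq_mul (L : ℕ) : trigScale L ^ 2 * (1 / 2 * (2 * Real.pi) ^ L) = 1 := by
  rw [trigScale_sq]
  have : (2 * Real.pi) ^ L ≠ 0 := by positivity
  field_simp

theorem l2Inner_cosFun_cosFun {m n : Fin L → ℤ} (hm : m ∈ posCone L) (hn : n ∈ posCone L) :
    l2Inner (cosFun m) (cosFun n) = if m = n then 1 else 0 := by
  have h : ∀ θ, cosFun m θ * cosFun n θ = trigScale L ^ 2 * (1 / 2 *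
      (circleCos (phase (m - n) θ) + circleCos (phase (m + n) θ))) := fun θ => by
    rw [cosFun_apply hm, cosFun_apply hn, phase_sub_left, phase_add_left,
      ← circleCos_mul_circleCos]
    ring
  simp only [l2Inner, h]
  rw [integral_const_mul, integral_const_mul,
    integral_add (integrable_circleCos_phase _) (integrable_circleCos_phase _),
    integral_circleCos_phase, integral_circleCos_phase, if_neg (posCone_add_ne_zero hm hn),
    add_zero]
  simp only [sub_eq_zero]
  split_ifs
  · exact trigScale_sq_mul L
  · simp

theorem l2Inner_sinFun_sinFun {m n : Fin L → ℤ} (hm : m ∈ posCone L) (hn : n ∈ posCone L) :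
    l2Inner (sinFun m) (sinFun n) = if m = n then 1 else 0 := by
  have h : ∀ θ, sinFun m θ * sinFun n θ = trigScale L ^ 2 * (1 / 2 *
      (circleCos (phase (m - n) θ) - circleCos (phase (m + n) θ))) := fun θ => by
    rw [sinFun_apply hm, sinFun_apply hn, phase_sub_left, phase_add_left,
      ← circleSin_mul_circleSin]
    ring
  simp only [l2Inner, h]
  rw [integral_const_mul, integral_const_mul,
    integral_sub (integrable_circleCos_phase _) (integrable_circleCos_phase _),
    integral_circleCos_phase, integral_circleCos_phase, if_neg (posCone_add_ne_zero hm hn),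
    sub_zero]
  simp only [sub_eq_zero]
  split_ifs
  · exact trigScale_sq_mul L
  · simp

theorem l2Inner_sinFun_cosFun {m n : Fin L → ℤ} (hm : m ∈ posCone L) (hn : n ∈ posCone L) :
    l2Inner (sinFun m) (cosFun n) = 0 := by
  have h : ∀ θ, sinFun m θ * cosFun n θ = trigScale L ^ 2 * (1 / 2 *
      (circleSin (phase (m - n) θ) + circleSin (phase (m + n) θ))) := fun θ => by
    rw [sinFun_apply hm, cosFun_apply hn, phase_sub_left, phase_add_left,
      ← circleSin_mul_circleCos]
    ring
  simp only [l2Inner, h]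
  rw [integral_const_mul, integral_const_mul,
    integral_add (integrable_circleSin_phase _) (integrable_circleSin_phase _),
    integral_circleSin_phase, integral_circleSin_phase]
  simp

theorem l2Inner_comm (f g : C(Torus L, ℝ)) : l2Inner f g = l2Inner g f := by
  simp [l2Inner, mul_comm]

/-! ### Coordinates on the space of trigonometric polynomials -/

variable (M : Finset (Fin L → ℤ))

/-- The trigonometric polynomial with given coefficients. -/
def trigFun (w : M ⊕ M → ℝ) : C(Torus L, ℝ) :=
  ∑ m, w (Sum.inl m) • cosFun m.1 + ∑ m, w (Sum.inr m) • sinFun m.1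

/-- The functions `A_m` and `B_m`, `m ∈ M`, as elements of the space they span. -/
def trigVec : M ⊕ M → L2Space (trigSpace M)
  | Sum.inl m => (show trigSpace M from
      ⟨cosFun m.1, Submodule.subset_span (Or.inl ⟨m.1, m.2, rfl⟩)⟩)
  | Sum.inr m => (show trigSpace M from
      ⟨sinFun m.1, Submodule.subset_span (Or.inr ⟨m.1, m.2, rfl⟩)⟩)

variable {M}

theorem orthonormal_trigVec (hM : ∀ m ∈ M, m ∈ posCone L) : Orthonormal ℝ (trigVec M) := by
  classical
  rw [orthonormal_iff_ite]
  rintro (m | m) (n | n)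
  · refine (l2Inner_cosFun_cosFun (hM m.1 m.2) (hM n.1 n.2)).trans ?_
    simp only [Sum.inl.injEq, Subtype.coe_inj]
  · refine (l2Inner_comm _ _).trans ((l2Inner_sinFun_cosFun (hM n.1 n.2) (hM m.1 m.2)).trans ?_)
    simp
  · refine (l2Inner_sinFun_cosFun (hM m.1 m.2) (hM n.1 n.2)).trans ?_
    simp
  · refine (l2Inner_sinFun_sinFun (hM m.1 m.2) (hM n.1 n.2)).trans ?_
    simp only [Sum.inr.injEq, Subtype.coe_inj]

/-- `L2Space.toFun` as a linear map. -/
def toFunLinear (V : Submodule ℝ C(Torus L, ℝ)) : L2Space V →ₗ[ℝ] C(Torus L, ℝ) where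
  toFun v := v.toFun
  map_add' _ _ := rfl
  map_smul' _ _ := rfl

theorem span_trigVec : ⊤ ≤ Submodule.span ℝ (Set.range (trigVec M)) := by
  intro v _
  have hinj : Function.Injective (toFunLinear (trigSpace M)) := fun a b h => Subtype.ext h
  have himg : toFunLinear (trigSpace M) '' Set.range (trigVec M) =
      cosFun '' (M : Set (Fin L → ℤ)) ∪ sinFun '' (M : Set (Fin L → ℤ)) := by
    ext f
    constructor
    · rintro ⟨_, ⟨m | m, rfl⟩, rfl⟩
      · exact Or.inl ⟨m.1, m.2, rfl⟩
      · exact Or.inr ⟨m.1, m.2, rfl⟩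
    · rintro (⟨m, hm, rfl⟩ | ⟨m, hm, rfl⟩)
      · exact ⟨_, ⟨Sum.inl ⟨m, hm⟩, rfl⟩, rfl⟩
      · exact ⟨_, ⟨Sum.inr ⟨m, hm⟩, rfl⟩, rfl⟩
  have hv : toFunLinear (trigSpace M) v ∈
      (Submodule.span ℝ (Set.range (trigVec M))).map (toFunLinear (trigSpace M)) := by
    rw [Submodule.map_span, himg]
    exact Subtype.property (show trigSpace M from v)
  obtain ⟨u, hu, huv⟩ := hv
  exact hinj huv ▸ hu

/-- The orthonormal basis of `V(M)` formed by the functions `A_m` and `B_m`. -/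
def trigBasis (hM : ∀ m ∈ M, m ∈ posCone L) :
    OrthonormalBasis (M ⊕ M) ℝ (L2Space (trigSpace M)) :=
  OrthonormalBasis.mk (orthonormal_trigVec hM) span_trigVec

theorem toFun_trigBasis_repr_symm (hM : ∀ m ∈ M, m ∈ posCone L) (w : EuclideanSpace ℝ (M ⊕ M)) :
    ((trigBasis hM).repr.symm w).toFun = trigFun M w := by
  have h : (trigBasis hM).repr.symm w = ∑ k, w k • trigVec M k := by
    rw [← (trigBasis hM).sum_repr_symm]
    simp [trigBasis]
  change toFunLinear (trigSpace M) _ = _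
  rw [h, map_sum, Fintype.sum_sum_type]
  simp only [map_smul]
  rfl

theorem mem_trigSpace_iff (v : C(Torus L, ℝ)) : v ∈ trigSpace M ↔ ∃ w, trigFun M w = v := by
  constructor
  · intro hv
    have := span_trigVec (M := M) (x := (show L2Space (trigSpace M) from
      (⟨v, hv⟩ : trigSpace M))) trivial
    obtain ⟨w, hw⟩ := (Submodule.mem_span_range_iff_exists_fun ℝ).1 this
    refine ⟨w, ?_⟩
    have h2 := congrArg (toFunLinear (trigSpace M)) hw
    rw [map_sum, Fintype.sum_sum_type] at h2
    simp only [map_smul] at h2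
    exact h2
  · rintro ⟨w, rfl⟩
    refine Submodule.add_mem _ (Submodule.sum_mem _ fun m _ => Submodule.smul_mem _ _
      (Submodule.subset_span (Or.inl ⟨m.1, m.2, rfl⟩))) (Submodule.sum_mem _ fun m _ =>
        Submodule.smul_mem _ _ (Submodule.subset_span (Or.inr ⟨m.1, m.2, rfl⟩)))

end Torus

/-! ### Differentials, ampleness and critical points as fibers. -/

section CriticalPoints

open Matrix

variable {L : ℕ} (M : Finset (Fin L → ℤ))

/-- The matrix whose columns are the frequencies. -/
def freqMatrix : Matrix (Fin L) M ℝ := Matrix.of fun j m => (m.1 j : ℝ)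

theorem freqMatrix_transpose_mulVec (y : Fin L → ℝ) (m : M) :
    ((freqMatrix M)ᵀ *ᵥ y) m = ∑ j, (m.1 j : ℝ) * y j := rfl

theorem phase_proj (m : Fin L → ℤ) (y : EuclideanSpace ℝ (Fin L)) :
    phase m (proj y) = ((∑ j, (m j : ℝ) * y j : ℝ) : AddCircle (2 * Real.pi)) := by
  refine Eq.trans ?_ (map_sum (QuotientAddGroup.mk' (AddSubgroup.zmultiples (2 * Real.pi)))
    (fun j => (m j : ℝ) * y j) Finset.univ).symm
  refine Finset.sum_congr rfl fun j _ => ?_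
  rw [← zsmul_eq_mul]
  rfl

theorem proj_add (y t : EuclideanSpace ℝ (Fin L)) : proj (y + t) = proj y + proj t := rfl

theorem proj_surjective_Ico (x : Torus L) : ∃ y ∈ Set.univ.pi fun _ : Fin L =>
    Set.Ico (0 : ℝ) (2 * Real.pi), proj (WithLp.toLp 2 y) = x := by
  have h : ∀ j, ∃ t ∈ Set.Ico (0 : ℝ) (2 * Real.pi), (t : AddCircle (2 * Real.pi)) = x j := by
    intro j
    have := AddCircle.coe_image_Ico_eq (2 * Real.pi) (0 : ℝ)
    rw [zero_add] at this
    exact (this.symm ▸ Set.mem_univ (x j) : x j ∈ _)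
  choose y hy hyx using h
  exact ⟨y, fun j _ => hy j, funext hyx⟩

theorem proj_injOn_Ico {y z : Fin L → ℝ}
    (hy : y ∈ Set.univ.pi fun _ : Fin L => Set.Ico (0 : ℝ) (2 * Real.pi))
    (hz : z ∈ Set.univ.pi fun _ : Fin L => Set.Ico (0 : ℝ) (2 * Real.pi))
    (h : proj (WithLp.toLp 2 y) = proj (WithLp.toLp 2 z)) : y = z := by
  funext j
  have hy' : y j ∈ Set.Ico 0 (0 + 2 * Real.pi) := by simpa using hy j trivial
  have hz' : z j ∈ Set.Ico 0 (0 + 2 * Real.pi) := by simpa using hz j trivial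
  exact (AddCircle.coe_eq_coe_iff_of_mem_Ico hy' hz').1 (congrFun h j)

/-- The coefficients of the differential of `trigFun M w` at the point with angular coordinates
`y`, as a combination of the frequencies. -/
def diffCoef (w : M ⊕ M → ℝ) (y : Fin L → ℝ) (m : M) : ℝ :=
  Real.cos (((freqMatrix M)ᵀ *ᵥ y) m) * w (Sum.inr m) -
    Real.sin (((freqMatrix M)ᵀ *ᵥ y) m) * w (Sum.inl m)

variable {M}

theorem trigFun_proj (hM : ∀ m ∈ M, m ∈ posCone L) (w : M ⊕ M → ℝ)
    (y : EuclideanSpace ℝ (Fin L)) :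
    trigFun M w (proj y) = ∑ m, trigScale L * (
      Real.cos (((freqMatrix M)ᵀ *ᵥ y) m) * w (Sum.inl m) +
      Real.sin (((freqMatrix M)ᵀ *ᵥ y) m) * w (Sum.inr m)) := by
  simp only [trigFun, ContinuousMap.add_apply, ContinuousMap.sum_apply, ContinuousMap.smul_apply,
    smul_eq_mul, ← Finset.sum_add_distrib]
  refine Finset.sum_congr rfl fun m _ => ?_
  rw [cosFun_apply (hM m.1 m.2), sinFun_apply (hM m.1 m.2), phase_proj, circleCos_coe,
    circleSin_coe, freqMatrix_transpose_mulVec]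
  ring

theorem hasDifferentialAt_trigFun (hM : ∀ m ∈ M, m ∈ posCone L) (w : M ⊕ M → ℝ)
    (y : Fin L → ℝ) :
    HasDifferentialAt (trigFun M w) (InnerProductSpace.toDual ℝ (EuclideanSpace ℝ (Fin L))
      (WithLp.toLp 2 (trigScale L • (freqMatrix M *ᵥ diffCoef M w y))))
      (proj (WithLp.toLp 2 y)) := by
  unfold HasDifferentialAt
  simp only [← proj_add, trigFun_proj hM]
  have hφ : ∀ m, HasFDerivAt (fun t : EuclideanSpace ℝ (Fin L) =>
      ((freqMatrix M)ᵀ *ᵥ (WithLp.toLp 2 y + t)) m)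
      (∑ j, (m.1 j : ℝ) • (EuclideanSpace.proj j : EuclideanSpace ℝ (Fin L) →L[ℝ] ℝ)) 0 := fun m => by
    simp only [freqMatrix_transpose_mulVec]
    exact HasFDerivAt.fun_sum fun j _ =>
      ((EuclideanSpace.proj j : EuclideanSpace ℝ (Fin L) →L[ℝ] ℝ).hasFDerivAt.const_add _).const_mul _
  refine (HasFDerivAt.fun_sum fun m _ => ((((hφ m).cos.mul_const _).add
    ((hφ m).sin.mul_const _)).const_mul _)).congr_fderiv ?_
  ext1 t
  have h1 : InnerProductSpace.toDual ℝ (EuclideanSpace ℝ (Fin L)) (WithLp.toLp 2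
      (trigScale L • (freqMatrix M *ᵥ diffCoef M w y))) t =
      ∑ m : M, trigScale L * (diffCoef M w y m * ∑ j, (m.1 j : ℝ) * t j) := by
    rw [InnerProductSpace.toDual_apply_apply, PiLp.inner_apply]
    simp only [Pi.smul_apply, smul_eq_mul, mulVec, dotProduct, freqMatrix, of_apply,
      RCLike.inner_apply, conj_trivial, Finset.mul_sum]
    rw [Finset.sum_comm]
    refine Finset.sum_congr rfl fun m _ => Finset.sum_congr rfl fun j _ => ?_
    ring
  rw [h1, _root_.sum_apply]
  refine Finset.sum_congr rfl fun m _ => ?_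
  simp only [_root_.smul_apply, _root_.add_apply, _root_.sum_apply, smul_eq_mul, diffCoef]
  simp only [PiLp.proj_apply, WithLp.ofLp_zero, add_zero]
  ring

theorem hasDifferentialAt_trigFun_iff (hM : ∀ m ∈ M, m ∈ posCone L) (w : M ⊕ M → ℝ)
    (y : Fin L → ℝ) (ξ : EuclideanSpace ℝ (Fin L)) :
    HasDifferentialAt (trigFun M w) (InnerProductSpace.toDual ℝ (EuclideanSpace ℝ (Fin L)) ξ)
      (proj (WithLp.toLp 2 y)) ↔
    ∀ j, ξ j = trigScale L * (freqMatrix M *ᵥ diffCoef M w y) j := by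
  have h := hasDifferentialAt_trigFun hM w y
  constructor
  · intro h2
    have h3 := (InnerProductSpace.toDual ℝ (EuclideanSpace ℝ (Fin L))).injective
      (HasFDerivAt.unique h2 h)
    intro j
    rw [h3]
    rfl
  · intro h2
    have h3 : ξ = WithLp.toLp 2 (trigScale L • (freqMatrix M *ᵥ diffCoef M w y)) := PiLp.ext h2
    rwa [h3]

theorem mem_criticalSet_trigFun_iff (hM : ∀ m ∈ M, m ∈ posCone L) (w : M ⊕ M → ℝ)
    (y : Fin L → ℝ) : proj (WithLp.toLp 2 y) ∈ criticalSet (trigFun M w) ↔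
      freqMatrix M *ᵥ diffCoef M w y = 0 := by
  have h := hasDifferentialAt_trigFun_iff hM w y 0
  rw [map_zero] at h
  refine h.trans ⟨fun h2 => funext fun j => ?_, fun h2 j => by simp [h2]⟩
  exact (mul_eq_zero.1 (h2 j).symm).resolve_left (trigScale_pos L).ne'

/-- At a fixed point, `w ↦ diffCoef M w y` is onto, being half of a rotation, so the attainable
covectors form the image of the frequency matrix, whatever the point. -/
theorem isAmple_trigSpace_iff (hM : ∀ m ∈ M, m ∈ posCone L) :
    IsAmple (trigSpace M) ↔ Function.Surjective (freqMatrix M).mulVec := by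
  constructor
  · intro h v
    obtain ⟨f, hf, hd⟩ := h (proj (WithLp.toLp 2 0)) (InnerProductSpace.toDual ℝ _
      (WithLp.toLp 2 (trigScale L • v)))
    obtain ⟨w, rfl⟩ := (mem_trigSpace_iff f).1 hf
    rw [hasDifferentialAt_trigFun_iff hM] at hd
    refine ⟨diffCoef M w 0, funext fun j => ?_⟩
    exact (mul_left_cancel₀ (trigScale_pos L).ne' (hd j)).symm
  · intro h x ξ
    obtain ⟨y, -, rfl⟩ := proj_surjective_Ico x
    obtain ⟨ξ, rfl⟩ := (InnerProductSpace.toDual ℝ (EuclideanSpace ℝ (Fin L))).surjective ξ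
    obtain ⟨r, hr⟩ := h ((trigScale L)⁻¹ • ξ.ofLp)
    refine ⟨trigFun M (Sum.elim
      (fun m => -Real.sin (((freqMatrix M)ᵀ *ᵥ y) m) * r m)
      (fun m => Real.cos (((freqMatrix M)ᵀ *ᵥ y) m) * r m)),
      (mem_trigSpace_iff _).2 ⟨_, rfl⟩, ?_⟩
    rw [hasDifferentialAt_trigFun_iff hM]
    have hd : diffCoef M (Sum.elim
      (fun m => -Real.sin (((freqMatrix M)ᵀ *ᵥ y) m) * r m)
      (fun m => Real.cos (((freqMatrix M)ᵀ *ᵥ y) m) * r m)) y = r := by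
      funext m
      have := Real.sin_sq_add_cos_sq (((freqMatrix M)ᵀ *ᵥ y) m)
      simp only [diffCoef, Sum.elim_inl, Sum.elim_inr]
      linear_combination r m * this
    intro j
    rw [hd, show freqMatrix M *ᵥ r = _ from hr, Pi.smul_apply, smul_eq_mul,
      mul_inv_cancel_left₀ (trigScale_pos L).ne']

/-- `twist` rotates by the angles `Aᵀ y` and `diffCoef` rotates back, so the kernel component of `z
∘ inr` reappears. -/
theorem diffCoef_twist (z : M ⊕ M → ℝ) {y : Fin L → ℝ}
    (hy : (freqMatrix M)ᵀ *ᵥ y = rowProj (freqMatrix M) *ᵥ (z ∘ Sum.inr)) :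
    diffCoef M (twist (freqMatrix M) z) y = z ∘ Sum.inr - (freqMatrix M)ᵀ *ᵥ y := by
  funext m
  have := Real.sin_sq_add_cos_sq (((freqMatrix M)ᵀ *ᵥ y) m)
  simp only [diffCoef, twist, Sum.elim_inl, Sum.elim_inr, ← hy, Pi.sub_apply, Function.comp_apply]
  linear_combination (z (Sum.inr m) - ((freqMatrix M)ᵀ *ᵥ y) m) * this

/-- The critical points of a trigonometric polynomial correspond to the points of a fiber of
`twist`. -/
theorem encard_criticalSet_trigFun (hM : ∀ m ∈ M, m ∈ posCone L)
    (hA : (freqMatrix M * (freqMatrix M)ᵀ).PosDef) (w : M ⊕ M → ℝ) :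
    (criticalSet (trigFun M w)).encard =
      (twistDomain (freqMatrix M) ∩ twist (freqMatrix M) ⁻¹' {w}).encard := by
  set A := freqMatrix M with hAdef
  have hu : IsUnit (A * Aᵀ).det := hA.det_pos.ne'.isUnit
  set X : (M ⊕ M → ℝ) → Fin L → ℝ := fun z => (A * Aᵀ)⁻¹ *ᵥ (A *ᵥ (z ∘ Sum.inr)) with hX
  have hXP : ∀ z, Aᵀ *ᵥ X z = rowProj A *ᵥ (z ∘ Sum.inr) := fun z => by
    simp [hX, rowProj, mulVec_mulVec, Matrix.mul_assoc]
  have hAu : ∀ z, A *ᵥ (z ∘ Sum.inr - Aᵀ *ᵥ X z) = 0 := fun z => by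
    rw [mulVec_sub, hXP, mulVec_rowProj hA, sub_self]
  set g : (M ⊕ M → ℝ) → Torus L := fun z => proj (WithLp.toLp 2 (X z)) with hg
  have himg : criticalSet (trigFun M w) = g '' (twistDomain A ∩ twist A ⁻¹' {w}) := by
    ext x
    constructor
    · intro hx
      obtain ⟨y, hy, rfl⟩ := proj_surjective_Ico x
      rw [mem_criticalSet_trigFun_iff hM] at hx
      -- The preimage of `w` attached to the critical point `y`: the coefficients rotated back by
      -- `Aᵀ y`, with `Aᵀ y` added to the derivative part to record the point.
      set z : M ⊕ M → ℝ := Sum.elim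
        (fun m => Real.cos ((Aᵀ *ᵥ y) m) * w (Sum.inl m) + Real.sin ((Aᵀ *ᵥ y) m) * w (Sum.inr m))
        (diffCoef M w y + Aᵀ *ᵥ y) with hz
      have hzy : X z = y := by
        simp only [hX, hz, Sum.elim_comp_inr]
        rw [mulVec_add, hx, zero_add, mulVec_mulVec y A Aᵀ, mulVec_mulVec, nonsing_inv_mul _ hu,
          one_mulVec]
      refine ⟨z, ⟨?_, ?_⟩, ?_⟩
      · change X z ∈ Set.univ.pi fun _ : Fin L => Set.Ico (0 : ℝ) (2 * Real.pi)
        rwa [hzy]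
      · change twist A z = w
        funext k
        rcases k with m | m <;>
        · have := Real.sin_sq_add_cos_sq ((Aᵀ *ᵥ y) m)
          simp only [twist, ← hXP, hzy, Sum.elim_inl, Sum.elim_inr]
          simp only [hz, Sum.elim_inl, Sum.elim_inr, Pi.add_apply, diffCoef]
          first
          | linear_combination w (Sum.inl m) * this
          | linear_combination w (Sum.inr m) * this
      · simp only [hg, hzy]
    · rintro ⟨z, ⟨-, hzw⟩, rfl⟩
      have hzw' : twist A z = w := hzw
      rw [hg, mem_criticalSet_trigFun_iff hM, ← hzw', diffCoef_twist z (hXP z)]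
      exact hAu z
  rw [himg]
  refine Set.InjOn.encard_image ?_
  -- Points of the box are determined by their image in the torus. Then both preimages come from `w`
  -- by the same inverse rotation, hence coincide.
  rintro z ⟨hz, hzw⟩ z' ⟨hz', hzw'⟩ h
  have hX' : X z = X z' := proj_injOn_Ico hz hz' h
  have ht : twist A z = twist A z' := (show _ = w from hzw).trans (show _ = w from hzw').symm
  have hr : z ∘ Sum.inr = z' ∘ Sum.inr := by
    have h1 := diffCoef_twist z (hXP z)
    have h2 := diffCoef_twist z' (hXP z')
    rw [← hX', ← ht, h1] at h2
    exact sub_left_injective h2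
  funext k
  rcases k with m | m
  · have h1 := congrFun ht (Sum.inl m)
    have h2 := congrFun ht (Sum.inr m)
    have hrm : z (Sum.inr m) = z' (Sum.inr m) := congrFun hr m
    simp only [twist, ← hr, Sum.elim_inl, Sum.elim_inr, ← hrm] at h1 h2
    have := Real.sin_sq_add_cos_sq ((rowProj A *ᵥ (z ∘ Sum.inr)) m)
    set s := Real.sin ((rowProj A *ᵥ (z ∘ Sum.inr)) m)
    set c := Real.cos ((rowProj A *ᵥ (z ∘ Sum.inr)) m)
    linear_combination c * h1 + s * h2 - (z (Sum.inl m) - z' (Sum.inl m)) * this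
  · exact congrFun hr m

end CriticalPoints

/-! ### From the spherical average to Gaussian integrals; Gram matrices. -/

section Expectation

open Matrix

variable {L : ℕ} {M : Finset (Fin L → ℤ)}

theorem criticalSet_smul {r : ℝ} (hr : r ≠ 0) (f : C(Torus L, ℝ)) :
    criticalSet (r • f : C(Torus L, ℝ)) = criticalSet f := by
  have key : ∀ (s : ℝ) (g : C(Torus L, ℝ)), criticalSet g ⊆ criticalSet (s • g : C(Torus L, ℝ)) := by
    intro s g x hx
    have := HasFDerivAt.const_smul (show HasFDerivAt _ _ _ from hx) s
    rw [smul_zero] at this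
    exact this
  refine Set.Subset.antisymm ?_ (key r f)
  have := key r⁻¹ (r • f)
  rwa [inv_smul_smul₀ hr] at this

/-- The expected number of critical points as a ratio of Gaussian integrals. -/
theorem expectedCritical_eq_div (V : Submodule ℝ C(Torus L, ℝ)) [FiniteDimensional ℝ V]
    [Nontrivial (L2Space V)]
    (hn : AEMeasurable (fun v : L2Space V => ((criticalSet v.toFun).encard : ℝ≥0∞)))
    (htop : ∫⁻ v : L2Space V, ENNReal.ofReal (Real.exp (-(1 / 2) * ‖v‖ ^ 2)) ≠ ∞)
    (hzero : ∫⁻ v : L2Space V, ENNReal.ofReal (Real.exp (-(1 / 2) * ‖v‖ ^ 2)) ≠ 0) :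
    expectedCritical V =
      (∫⁻ v : L2Space V, ((criticalSet v.toFun).encard : ℝ≥0∞) *
        ENNReal.ofReal (Real.exp (-(1 / 2) * ‖v‖ ^ 2))) /
      ∫⁻ v : L2Space V, ENNReal.ofReal (Real.exp (-(1 / 2) * ‖v‖ ^ 2)) := by
  have hg : Measurable fun r : ℝ => ENNReal.ofReal (Real.exp (-(1 / 2) * r ^ 2)) := by fun_prop
  have h1 := lintegral_mul_fun_norm_eq volume hn (fun r v hr => by
    rw [show (r • v).toFun = r • v.toFun from rfl, criticalSet_smul hr.ne']) hg
  -- The total Gaussian mass has the same radial factor as the numerator, so that factor cancels;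
  -- `htop` and `hzero` make it finite and nonzero.
  have h2 := lintegral_mul_fun_norm_eq (volume : Measure (L2Space V)) (n := fun _ => 1)
    aemeasurable_const (fun _ _ _ => rfl) hg
  simp only [one_mul, lintegral_one] at h2
  rw [h2] at htop hzero
  rw [h1, h2, expectedCritical, ENNReal.mul_div_mul_right _ _ (right_ne_zero_of_mul hzero)]
  intro h
  rw [h, ENNReal.mul_top (left_ne_zero_of_mul hzero)] at htop
  exact htop rfl

/-- The matrix of the scaled quadratic monomials `m_i m_j` of the frequencies; its Gram matrix is
the covariance matrix. -/
def momentMatrix (M : Finset (Fin L → ℤ)) : Matrix (SymIdx L) M ℝ :=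
  trigScale L • Matrix.of fun p m => (m.1 p.1.1 : ℝ) * (m.1 p.1.2 : ℝ)

/-- The orthonormal basis identifies the `L²` volume with Lebesgue measure on coefficients, where
the fibers of `twist` have been counted. -/
theorem expectedCritical_trigSpace (hM : ∀ m ∈ M, m ∈ posCone L) (hne : M.Nonempty)
    (hA : (freqMatrix M * (freqMatrix M)ᵀ).PosDef) :
    expectedCritical (trigSpace M) =
      ENNReal.ofReal (fiberConst (freqMatrix M) * (2 * Real.pi) ^ L) *
        (∫⁻ a : M → ℝ, ENNReal.ofReal (Real.exp (-(1 / 2) * (a ⬝ᵥ a))) *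
          ENNReal.ofReal |(freqMatrix M * diagonal a * (freqMatrix M)ᵀ).det|) /
        ENNReal.ofReal (√(2 * Real.pi) ^ (2 * M.card)) := by
  obtain ⟨h1, h2⟩ := lintegral_encard_twist hA
  rw [Fintype.card_fin] at h2
  have hmp : MeasurePreserving (fun v : L2Space (trigSpace M) => ((trigBasis hM).repr v).ofLp) :=
    (PiLp.volume_preserving_ofLp (M ⊕ M)).comp (trigBasis hM).measurePreserving_repr
  have hcrit : ∀ v : L2Space (trigSpace M), ((criticalSet v.toFun).encard : ℝ≥0∞) =
      ((twistDomain (freqMatrix M) ∩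
        twist (freqMatrix M) ⁻¹' {((trigBasis hM).repr v).ofLp}).encard : ℝ≥0∞) := fun v => by
    rw [← encard_criticalSet_trigFun hM hA, ← toFun_trigBasis_repr_symm hM,
      LinearIsometryEquiv.symm_apply_apply]
  have hnorm : ∀ v : L2Space (trigSpace M), ‖v‖ ^ 2 =
      ((trigBasis hM).repr v).ofLp ⬝ᵥ ((trigBasis hM).repr v).ofLp := fun v => by
    rw [← (trigBasis hM).repr.norm_map, EuclideanSpace.norm_sq_eq]
    simp [dotProduct, pow_two]
  have hemb : MeasurableEmbedding
      (fun v : L2Space (trigSpace M) => ((trigBasis hM).repr v).ofLp) :=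
    (MeasurableEquiv.toLp 2 (M ⊕ M → ℝ)).symm.measurableEmbedding.comp
      (trigBasis hM).repr.toHomeomorph.measurableEmbedding
  have hgauss : ∫⁻ v : L2Space (trigSpace M), ENNReal.ofReal (Real.exp (-(1 / 2) * ‖v‖ ^ 2)) =
      ENNReal.ofReal (√(2 * Real.pi) ^ (2 * M.card)) := by
    simp only [hnorm]
    rw [hmp.lintegral_comp_emb hemb
      (fun w => ENNReal.ofReal (Real.exp (-(1 / 2) * (w ⬝ᵥ w)))),
      lintegral_exp_neg_half_dotProduct]
    simp [two_mul]
  have hpos : 0 < √(2 * Real.pi) ^ (2 * M.card) := by positivity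
  have hnt : Nontrivial (L2Space (trigSpace M)) := by
    obtain ⟨m, hm⟩ := hne
    exact ⟨⟨trigBasis hM (Sum.inl ⟨m, hm⟩), 0, (trigBasis hM).orthonormal.ne_zero _⟩⟩
  rw [expectedCritical_eq_div]
  · rw [hgauss]
    simp only [hcrit, hnorm]
    rw [hmp.lintegral_comp_emb hemb (fun w => ((twistDomain (freqMatrix M) ∩
      twist (freqMatrix M) ⁻¹' {w}).encard : ℝ≥0∞) *
        ENNReal.ofReal (Real.exp (-(1 / 2) * (w ⬝ᵥ w)))), h2]
  · simp only [hcrit]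
    exact h1.comp_quasiMeasurePreserving hmp.quasiMeasurePreserving
  · rw [hgauss]
    exact ENNReal.ofReal_ne_top
  · rw [hgauss]
    exact (ENNReal.ofReal_pos.2 hpos).ne'

theorem symMatrix_apply (x : SymIdx L → ℝ) (i j : Fin L) :
    symMatrix x i j = x ⟨(min i j, max i j), min_le_max⟩ := by
  rw [symMatrix, Matrix.sum_apply, Finset.sum_eq_single ⟨(min i j, max i j), min_le_max⟩]
  · rcases le_total i j with h | h <;> simp [symBasis, h]
  · rintro ⟨⟨k, l⟩, hkl⟩ - hp
    rw [Matrix.smul_apply, symBasis, of_apply, smul_eq_mul]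
    rw [if_neg, mul_zero]
    rintro (⟨rfl, rfl⟩ | ⟨rfl, rfl⟩)
    · simp [min_eq_left hkl, max_eq_right hkl] at hp
    · simp [min_eq_right hkl, max_eq_left hkl] at hp
  · simp

/-- Makes the Jacobian a function of a linear image of `a` in the space of symmetric matrices. -/
theorem symMatrix_momentMatrix_mulVec (a : M → ℝ) :
    symMatrix (momentMatrix M *ᵥ a) =
      trigScale L • (freqMatrix M * diagonal a * (freqMatrix M)ᵀ) := by
  ext i j
  rw [symMatrix_apply, Matrix.smul_apply, mul_apply]
  simp only [mulVec, dotProduct, momentMatrix, Matrix.smul_apply, of_apply, mul_diagonal, freqMatrix,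
    transpose_apply, smul_eq_mul, Finset.mul_sum]
  refine Finset.sum_congr rfl fun m _ => ?_
  rcases le_total i j with h | h
  · rw [min_eq_left h, max_eq_right h]
    ring
  · rw [min_eq_right h, max_eq_left h]
    ring

theorem l2Inner_sum_cosFun (hM : ∀ m ∈ M, m ∈ posCone L) (c d : M → ℝ) :
    l2Inner (∑ m, c m • cosFun m.1) (∑ m, d m • cosFun m.1) = c ⬝ᵥ d := by
  have h := (trigBasis hM).repr.symm.inner_map_map (WithLp.toLp 2 (Sum.elim c 0))
    (WithLp.toLp 2 (Sum.elim d 0))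
  have h2 : ∀ c : M → ℝ, trigFun M (Sum.elim c 0) = ∑ m, c m • cosFun m.1 := fun c => by
    simp [trigFun]
  change l2Inner ((trigBasis hM).repr.symm _).toFun ((trigBasis hM).repr.symm _).toFun = _ at h
  rw [toFun_trigBasis_repr_symm, toFun_trigBasis_repr_symm, h2, h2] at h
  rw [h, PiLp.inner_apply]
  simp [dotProduct, mul_comm]

theorem aVec_eq (p : SymIdx L) :
    aVec M p.1.1 p.1.2 = ∑ m : M, (-momentMatrix M p m) • cosFun m.1 := by
  rw [aVec, ← trigScale, Finset.smul_sum, ← Finset.sum_coe_sort M]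
  refine Finset.sum_congr rfl fun m _ => ?_
  simp [momentMatrix, smul_smul]

/-- The cosines are orthonormal, and the minus signs in the two vectors cancel. -/
theorem covMatrix_eq (hM : ∀ m ∈ M, m ∈ posCone L) :
    covMatrix M = momentMatrix M * (momentMatrix M)ᵀ := by
  ext p q
  rw [covMatrix, of_apply, aVec_eq, aVec_eq, l2Inner_sum_cosFun hM, mul_apply]
  simp [dotProduct]

theorem covMatrix_apply (hM : ∀ m ∈ M, m ∈ posCone L) (p q : SymIdx L) :
    covMatrix M p q = 2 / (2 * Real.pi) ^ L *
      ∑ m ∈ M, (m p.1.1 : ℝ) * (m p.1.2 : ℝ) * (m q.1.1 : ℝ) * (m q.1.2 : ℝ) := by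
  rw [covMatrix_eq hM, mul_apply, ← trigScale_sq, Finset.mul_sum, ← Finset.sum_coe_sort M]
  refine Finset.sum_congr rfl fun m _ => ?_
  simp only [momentMatrix, Matrix.smul_apply, of_apply, transpose_apply, smul_eq_mul]
  ring

theorem posDef_mul_transpose {κ ι : Type*} [Fintype κ] [Fintype ι] {K : Matrix κ ι ℝ}
    (h : ∀ y, y ᵥ* K = 0 → y = 0) : (K * Kᵀ).PosDef := by
  rw [← conjTranspose_eq_transpose_of_trivial]
  refine PosDef.mul_conjTranspose_self K fun y z hyz => ?_
  have : (y - z) ᵥ* K = 0 := by rw [sub_vecMul, sub_eq_zero]; exact hyz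
  exact sub_eq_zero.1 (h _ this)

theorem posDef_covMatrix (hM : ∀ m ∈ M, m ∈ posCone L)
    (hlin : LinearIndependent ℝ (fun p : SymIdx L => aVec M p.1.1 p.1.2)) :
    (covMatrix M).PosDef := by
  rw [covMatrix_eq hM]
  refine posDef_mul_transpose fun y hy => funext fun p => ?_
  refine Fintype.linearIndependent_iff.1 hlin y ?_ p
  simp only [aVec_eq, Finset.smul_sum, smul_smul]
  rw [Finset.sum_comm]
  refine Finset.sum_eq_zero fun m _ => ?_
  rw [← Finset.sum_smul]
  have := congrFun hy m
  simp only [vecMul, dotProduct, Pi.zero_apply] at this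
  simp [this]

/-- A relation `∑ y_j m_j = 0` valid for all frequencies, multiplied by `m_k`, becomes a relation
among the vectors `a_{jk}`, `k` fixed. -/
theorem posDef_freqMatrix (hlin : LinearIndependent ℝ (fun p : SymIdx L => aVec M p.1.1 p.1.2)) :
    (freqMatrix M * (freqMatrix M)ᵀ).PosDef := by
  refine posDef_mul_transpose fun y hy => funext fun k => ?_
  have hinj : Function.Injective
      fun j : Fin L => (⟨(min j k, max j k), min_le_max⟩ : SymIdx L) := by
    intro i j hij
    simp only [Subtype.mk.injEq, Prod.mk.injEq] at hij
    grind
  refine Fintype.linearIndependent_iff.1 (hlin.comp _ hinj) y ?_ k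
  simp only [Function.comp_def, aVec_eq, Finset.smul_sum, smul_smul]
  rw [Finset.sum_comm]
  refine Finset.sum_eq_zero fun m _ => ?_
  rw [← Finset.sum_smul]
  have hm := congrFun hy m
  simp only [vecMul, dotProduct, Pi.zero_apply, freqMatrix, of_apply] at hm
  have hs : ∑ j, y j * -momentMatrix M ⟨(min j k, max j k), min_le_max⟩ m =
      -(trigScale L * m.1 k) * ∑ j, y j * (m.1 j : ℝ) := by
    rw [Finset.mul_sum]
    refine Finset.sum_congr rfl fun j _ => ?_
    simp only [momentMatrix, Matrix.smul_apply, of_apply, smul_eq_mul]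
    rcases le_total j k with h | h
    · rw [min_eq_left h, max_eq_right h]
      ring
    · rw [min_eq_right h, max_eq_left h]
      ring
  rw [hs, hm, mul_zero, zero_smul]

theorem aCoef_eq (j k : Fin L) :
    aCoef M j k = trigScale L ^ 2 * (freqMatrix M * (freqMatrix M)ᵀ) j k := by
  rw [aCoef, trigScale_sq, mul_apply, ← Finset.sum_coe_sort M]
  rfl

end Expectation

/-! ### Determinants, ampleness and finiteness. -/

section Determinants

open Matrix

/-- The determinant of a matrix with constant diagonal and constant off-diagonal entries. -/
theorem det_of_diag_off {L : ℕ} (hL : 0 < L) {T : Matrix (Fin L) (Fin L) ℝ} {a b : ℝ}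
    (hd : ∀ j, T j j = a) (ho : ∀ j k, j ≠ k → T j k = b) :
    T.det = (a - b) ^ (L - 1) * (a + ((L : ℝ) - 1) * b) := by
  by_cases hab : a = b
  · subst hab
    rcases Nat.lt_or_ge 1 L with h1 | h1
    · rw [sub_self, zero_pow (by omega), zero_mul]
      refine det_zero_of_row_eq (i := ⟨0, hL⟩) (j := ⟨1, h1⟩) (by simp) (funext fun k => ?_)
      have h : ∀ j k, T j k = a := fun j k => by
        by_cases hjk : j = k
        · rw [hjk, hd]
        · exact ho j k hjk
      rw [h, h]
    · obtain rfl : L = 1 := by omega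
      simp [hd]
  · have hab' : a - b ≠ 0 := sub_ne_zero.2 hab
    -- A rank one perturbation of a scalar matrix. The case `a = b`, excluded here, has equal rows,
    -- or `0 ^ 0 = 1` when `L = 1`.
    have hT : T = (a - b) • (1 + replicateCol Unit (fun _ => b / (a - b)) *
        replicateRow Unit (fun _ => (1 : ℝ))) := by
      ext j k
      by_cases hjk : j = k
      · subst hjk
        simp [hd, mul_apply]
        field_simp
        ring
      · simp [ho j k hjk, one_apply_ne hjk, mul_apply]
        field_simp
    rw [hT, det_smul, det_one_add_replicateCol_mul_replicateRow, Fintype.card_fin]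
    obtain ⟨n, rfl⟩ : ∃ n, L = n + 1 := ⟨L - 1, by omega⟩
    simp [dotProduct, pow_succ]
    field_simp
    ring

theorem mulVec_surjective_iff_posDef {κ ι : Type*} [Fintype κ] [DecidableEq κ] [Fintype ι]
    {K : Matrix κ ι ℝ} : Function.Surjective K.mulVec ↔ (K * Kᵀ).PosDef := by
  constructor
  · intro h
    refine posDef_mul_transpose fun y hy => ?_
    obtain ⟨v, hv⟩ := h y
    have h2 : y ⬝ᵥ y = 0 := by
      nth_rewrite 2 [← hv]
      rw [dotProduct_mulVec, hy, zero_dotProduct]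
    exact dotProduct_self_eq_zero.1 h2
  · intro h y
    refine ⟨Kᵀ *ᵥ ((K * Kᵀ)⁻¹ *ᵥ y), ?_⟩
    rw [mulVec_mulVec, mulVec_mulVec, mul_nonsing_inv _ h.det_pos.ne'.isUnit, one_mulVec]

/-- A weighted Gram determinant is integrable with respect to a Gaussian measure. -/
theorem lintegral_exp_mul_abs_det_ne_top {κ ι : Type*} [Fintype κ] [DecidableEq κ] [Fintype ι]
    [DecidableEq ι] (A : Matrix κ ι ℝ) :
    ∫⁻ a : ι → ℝ, ENNReal.ofReal (Real.exp (-(1 / 2) * (a ⬝ᵥ a))) *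
      ENNReal.ofReal |(A * diagonal a * Aᵀ).det| ≠ ∞ := by
  obtain ⟨B, hB⟩ := Finite.exists_le fun x : κ × κ × ι => |A x.1 x.2.2 * A x.2.1 x.2.2|
  -- With `n = card κ`, one `n!` counts the terms of the determinant and the other comes from `x ^ n
  -- ≤ n! * exp x`.
  set c : ℝ := (Fintype.card κ).factorial * (Fintype.card κ).factorial with hc
  have hentry : ∀ (a : ι → ℝ) i j, |(A * diagonal a * Aᵀ) i j| ≤ |B| * ∑ m, |a m| := by
    intro a i j
    rw [mul_apply, Finset.mul_sum]
    refine (Finset.abs_sum_le_sum_abs _ _).trans (Finset.sum_le_sum fun m _ => ?_)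
    rw [mul_diagonal, transpose_apply, mul_right_comm, abs_mul]
    exact mul_le_mul_of_nonneg_right ((hB (i, j, m)).trans (le_abs_self B)) (abs_nonneg _)
  have hbound : ∀ a : ι → ℝ, Real.exp (-(1 / 2) * (a ⬝ᵥ a)) * |(A * diagonal a * Aᵀ).det| ≤
      c * ∏ m, Real.exp (|B| ^ 2) * Real.exp (-(1 / 4) * a m ^ 2) := by
    intro a
    set S := ∑ m, |a m|
    have hS : 0 ≤ |B| * S := mul_nonneg (abs_nonneg _) (Finset.sum_nonneg fun m _ => abs_nonneg _)
    have h1 : |(A * diagonal a * Aᵀ).det| ≤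
        (Fintype.card κ).factorial • (|B| * S) ^ Fintype.card κ :=
      det_le (abv := AbsoluteValue.abs) (hentry a)
    have h2 := Real.pow_div_factorial_le_exp _ hS (Fintype.card κ)
    rw [div_le_iff₀ (by positivity)] at h2
    have h3 : |(A * diagonal a * Aᵀ).det| ≤ c * Real.exp (|B| * S) := by
      rw [nsmul_eq_mul] at h1
      refine h1.trans ?_
      rw [hc, mul_assoc]
      refine mul_le_mul_of_nonneg_left ?_ (by positivity)
      linarith
    have h4 : Real.exp (-(1 / 2) * (a ⬝ᵥ a)) * Real.exp (|B| * S) ≤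
        ∏ m, Real.exp (|B| ^ 2) * Real.exp (-(1 / 4) * a m ^ 2) := by
      simp only [← Real.exp_add]
      rw [← Real.exp_sum, Real.exp_le_exp, dotProduct, Finset.mul_sum, Finset.mul_sum,
        ← Finset.sum_add_distrib]
      refine Finset.sum_le_sum fun m _ => ?_
      -- `|B| |a_m| ≤ |B|² + a_m² / 4`: half of the Gaussian decay absorbs the linear growth in the
      -- exponent.
      nlinarith [sq_nonneg (|B| - |a m| / 2), sq_abs (a m)]
    calc _ ≤ Real.exp (-(1 / 2) * (a ⬝ᵥ a)) * (c * Real.exp (|B| * S)) :=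
          mul_le_mul_of_nonneg_left h3 (Real.exp_pos _).le
      _ = c * (Real.exp (-(1 / 2) * (a ⬝ᵥ a)) * Real.exp (|B| * S)) := by ring
      _ ≤ _ := mul_le_mul_of_nonneg_left h4 (by positivity)
  have hint : Integrable fun a : ι → ℝ =>
      c * ∏ m, Real.exp (|B| ^ 2) * Real.exp (-(1 / 4) * a m ^ 2) :=
    (Integrable.fintype_prod (f := fun _ t => Real.exp (|B| ^ 2) * Real.exp (-(1 / 4) * t ^ 2))
      fun _ => (integrable_exp_neg_mul_sq (by norm_num)).const_mul _).const_mul c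
  refine ne_top_of_le_ne_top (b := ∫⁻ a : ι → ℝ, ENNReal.ofReal
    (c * ∏ m, Real.exp (|B| ^ 2) * Real.exp (-(1 / 4) * a m ^ 2))) ?_ ?_
  · exact hint.lintegral_lt_top.ne
  · refine lintegral_mono fun a => ?_
    rw [← ENNReal.ofReal_mul (Real.exp_pos _).le]
    exact ENNReal.ofReal_le_ofReal (hbound a)

variable {L : ℕ} {M : Finset (Fin L → ℤ)}

theorem det_freqMatrix_mul_transpose (hL : 0 < L) (hM : ∀ m ∈ M, m ∈ posCone L)
    (hs : IsSymmetric M) :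
    (trigScale L ^ 2) ^ L * (freqMatrix M * (freqMatrix M)ᵀ).det =
      (aDiag M - bOff M) ^ (L - 1) * (aDiag M + ((L : ℝ) - 1) * bOff M) := by
  rw [← det_of_diag_off hL (T := trigScale L ^ 2 • (freqMatrix M * (freqMatrix M)ᵀ)) (a := aDiag M)
    (b := bOff M), det_smul, Fintype.card_fin]
  · intro j
    rw [← aCoef_diag hM hs j, aCoef_eq, Matrix.smul_apply, smul_eq_mul]
  · intro j k hjk
    rw [← aCoef_off hM hs hjk, aCoef_eq, Matrix.smul_apply, smul_eq_mul]

theorem aCoef_self_nonneg (j : Fin L) : 0 ≤ aCoef M j j :=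
  mul_nonneg (by positivity) (Finset.sum_nonneg fun m _ => mul_self_nonneg _)

/-- For `L > 1`, `2 (a - b)` is a positive multiple of a sum of squares `(m_i - m_j)²`. The sign is
needed to manipulate real powers of `a - b`. -/
theorem aDiag_sub_bOff_nonneg (hL : 0 < L) (hM : ∀ m ∈ M, m ∈ posCone L) (hs : IsSymmetric M) :
    0 ≤ aDiag M - bOff M := by
  by_cases h1 : 1 < L
  · set i : Fin L := ⟨0, hL⟩
    set j : Fin L := ⟨1, h1⟩
    have hij : i ≠ j := by simp [i, j]
    have h : aCoef M i i + aCoef M j j - 2 * aCoef M i j =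
        2 / (2 * Real.pi) ^ L * ∑ m ∈ M, ((m i : ℝ) - m j) ^ 2 := by
      simp only [aCoef, Finset.mul_sum, ← Finset.sum_add_distrib, ← Finset.sum_sub_distrib]
      refine Finset.sum_congr rfl fun m _ => ?_
      ring
    have h0 : 0 ≤ 2 / (2 * Real.pi) ^ L * ∑ m ∈ M, ((m i : ℝ) - m j) ^ 2 :=
      mul_nonneg (by positivity) (Finset.sum_nonneg fun m _ => sq_nonneg _)
    rw [← h, aCoef_diag hM hs, aCoef_diag hM hs, aCoef_off hM hs hij] at h0
    linarith
  · rw [bOff, dif_neg h1, sub_zero, ← aCoef_diag hM hs ⟨0, hL⟩]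
    exact aCoef_self_nonneg _

theorem isAmple_trigSpace_iff_ne (hL : 0 < L) (hM : ∀ m ∈ M, m ∈ posCone L)
    (hs : IsSymmetric M) :
    IsAmple (trigSpace M) ↔ aDiag M ≠ bOff M ∧ aDiag M + ((L : ℝ) - 1) * bOff M ≠ 0 := by
  have hdet := det_freqMatrix_mul_transpose hL hM hs
  have hc : (trigScale L ^ 2) ^ L ≠ 0 := by
    have := trigScale_pos L
    positivity
  have hpsd : (freqMatrix M * (freqMatrix M)ᵀ).PosSemidef := by
    rw [← conjTranspose_eq_transpose_of_trivial]
    exact posSemidef_self_mul_conjTranspose _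
  rw [isAmple_trigSpace_iff hM, mulVec_surjective_iff_posDef, hpsd.posDef_iff_det_ne_zero,
    ← mul_ne_zero_iff_left hc, hdet, mul_ne_zero_iff]
  -- For `L = 1` the exponent is `0`, so the determinant does not see `a ≠ b`; it then follows from
  -- the other condition, since `b = 0`.
  refine and_congr_left fun h => ?_
  rcases Nat.lt_or_ge 1 L with h1 | h1
  · rw [pow_ne_zero_iff (by omega), sub_ne_zero]
  · obtain rfl : L = 1 := by omega
    have hb : bOff M = 0 := by simp [bOff]
    simpa [hb] using h

theorem card_symIdx (L : ℕ) : Fintype.card (SymIdx L) = L + L.choose 2 := by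
  have h := Fintype.card_congr (Sym2.sortEquiv (α := Fin L))
  rw [Sym2.card, Fintype.card_fin, Nat.choose_succ_succ, Nat.choose_one_right] at h
  rw [h]

theorem continuous_symMatrix : Continuous (symMatrix (L := L)) := by
  unfold symMatrix
  fun_prop

end Determinants

/-! ### Assembly of the constant and of the formula. -/

section Main

open Matrix

variable {L : ℕ} {M : Finset (Fin L → ℤ)}

/-- The constant in front of the integral over the symmetric matrices. -/
theorem fiberConst_mul_fiberConst (hL : 0 < L) (hM : ∀ m ∈ M, m ∈ posCone L)
    (hs : IsSymmetric M) (hA : (freqMatrix M * (freqMatrix M)ᵀ).PosDef) :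
    fiberConst (freqMatrix M) * (2 * Real.pi) ^ L *
        (fiberConst (momentMatrix M) * (trigScale L ^ L)⁻¹) / √(2 * Real.pi) ^ (2 * M.card) =
      1 / ((2 * Real.pi) ^ ((1 / 2 : ℝ) * (L.choose 2 : ℝ)) *
        (aDiag M - bOff M) ^ (((L : ℝ) - 1) / 2) *
        (aDiag M + ((L : ℝ) - 1) * bOff M) ^ (1 / 2 : ℝ) *
        (covMatrix M).det ^ (1 / 2 : ℝ)) := by
  have hdet := det_freqMatrix_mul_transpose hL hM hs
  have hab := aDiag_sub_bOff_nonneg hL hM hs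
  have ht := trigScale_pos L
  have hposdet : 0 < (aDiag M - bOff M) ^ (L - 1) * (aDiag M + ((L : ℝ) - 1) * bOff M) := by
    rw [← hdet]
    exact mul_pos (by positivity) hA.det_pos
  have hsum : 0 < aDiag M + ((L : ℝ) - 1) * bOff M :=
    pos_of_mul_pos_right hposdet (pow_nonneg hab _)
  have h1 : (aDiag M - bOff M) ^ (((L : ℝ) - 1) / 2) *
      (aDiag M + ((L : ℝ) - 1) * bOff M) ^ (1 / 2 : ℝ) =
        trigScale L ^ L * √(freqMatrix M * (freqMatrix M)ᵀ).det := by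
    have hexp : ((L : ℝ) - 1) / 2 = ((L - 1 : ℕ) : ℝ) * (1 / 2) := by
      rw [Nat.cast_sub hL]
      push_cast
      ring
    rw [hexp, Real.rpow_mul hab, Real.rpow_natCast, ← Real.mul_rpow (pow_nonneg hab _) hsum.le,
      ← hdet, ← Real.sqrt_eq_rpow, Real.sqrt_mul (by positivity), ← pow_mul, mul_comm 2 L,
      pow_mul, Real.sqrt_sq (by positivity)]
  have h2 : (2 * Real.pi) ^ ((1 / 2 : ℝ) * (L.choose 2 : ℝ)) = √(2 * Real.pi) ^ L.choose 2 := by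
    rw [Real.rpow_mul Real.two_pi_pos.le, ← Real.sqrt_eq_rpow, Real.rpow_natCast]
  have h3 : (2 * Real.pi) ^ L = √(2 * Real.pi) ^ L * √(2 * Real.pi) ^ L := by
    rw [← mul_pow, Real.mul_self_sqrt Real.two_pi_pos.le]
  -- With `s = √(2π)`, the exponents are `N - L`, `2L`, `N - L - L.choose 2` and `-2N`, leaving `s`
  -- to the power `-L.choose 2`.
  rw [mul_assoc ((2 * Real.pi) ^ ((1 / 2 : ℝ) * (L.choose 2 : ℝ))), h1, h2, h3, fiberConst,
    fiberConst, card_symIdx, ← covMatrix_eq hM, Fintype.card_fin, Fintype.card_coe,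
    ← Real.sqrt_eq_rpow, two_mul M.card, pow_add, pow_add]
  have hs0 : √(2 * Real.pi) ≠ 0 := (Real.sqrt_pos.2 Real.two_pi_pos).ne'
  field_simp

theorem expectedCritical_eq (hL : 0 < L) (hM : ∀ m ∈ M, m ∈ posCone L) (hs : IsSymmetric M)
    (hne : M.Nonempty)
    (hlin : LinearIndependent ℝ (fun p : SymIdx L => aVec M p.1.1 p.1.2)) :
    expectedCritical (trigSpace M) =
      ENNReal.ofReal (1 / ((2 * Real.pi) ^ ((1 / 2 : ℝ) * (L.choose 2 : ℝ)) *
        (aDiag M - bOff M) ^ (((L : ℝ) - 1) / 2) *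
        (aDiag M + ((L : ℝ) - 1) * bOff M) ^ (1 / 2 : ℝ) *
        (covMatrix M).det ^ (1 / 2 : ℝ)) *
      ∫ x : SymIdx L → ℝ, Real.exp (-(1 / 2) * (((covMatrix M)⁻¹).mulVec x ⬝ᵥ x)) *
        |(symMatrix x).det|) := by
  have hA := posDef_freqMatrix hlin
  have hC := posDef_covMatrix hM hlin
  have hK : (momentMatrix M * (momentMatrix M)ᵀ).PosDef := covMatrix_eq hM ▸ hC
  have ht := trigScale_pos L
  have hdetc : Continuous fun x : SymIdx L → ℝ => |(symMatrix x).det| :=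
    continuous_symMatrix.matrix_det.abs
  have hJc : Continuous fun x : SymIdx L → ℝ =>
      Real.exp (-(1 / 2) * (((covMatrix M)⁻¹).mulVec x ⬝ᵥ x)) * |(symMatrix x).det| := by
    refine Continuous.mul ?_ hdetc
    unfold mulVec dotProduct
    fun_prop
  have hJ0 : ∀ x : SymIdx L → ℝ,
      0 ≤ Real.exp (-(1 / 2) * (((covMatrix M)⁻¹).mulVec x ⬝ᵥ x)) * |(symMatrix x).det| :=
    fun x => mul_nonneg (Real.exp_pos _).le (abs_nonneg _)
  have hfK : 0 < fiberConst (momentMatrix M) := by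
    have := hK.det_pos
    unfold fiberConst
    positivity
  have hcomp : ∫⁻ a : M → ℝ, ENNReal.ofReal (Real.exp (-(1 / 2) * (a ⬝ᵥ a))) *
      ENNReal.ofReal |(freqMatrix M * diagonal a * (freqMatrix M)ᵀ).det| =
      ENNReal.ofReal (fiberConst (momentMatrix M) * (trigScale L ^ L)⁻¹) *
        ∫⁻ x : SymIdx L → ℝ, ENNReal.ofReal
          (Real.exp (-(1 / 2) * (((covMatrix M)⁻¹).mulVec x ⬝ᵥ x)) * |(symMatrix x).det|) := by
    have h1 := lintegral_exp_mul_comp_mulVec hK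
      (h := fun x => ENNReal.ofReal ((trigScale L ^ L)⁻¹ * |(symMatrix x).det|)) (by
        have := hdetc.measurable
        fun_prop)
    rw [← covMatrix_eq hM] at h1
    rw [ENNReal.ofReal_mul hfK.le, mul_assoc, ← lintegral_const_mul _ (by
      have := hJc.measurable
      fun_prop)]
    refine Eq.trans (lintegral_congr fun a => ?_) (h1.trans ?_)
    · rw [symMatrix_momentMatrix_mulVec, det_smul, Fintype.card_fin, abs_mul,
        abs_of_pos (pow_pos ht L), inv_mul_cancel_left₀ (pow_pos ht L).ne']
    · congr 1
      refine lintegral_congr fun x => ?_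
      rw [← ENNReal.ofReal_mul (Real.exp_pos _).le,
        ← ENNReal.ofReal_mul (inv_pos.2 (pow_pos ht L)).le]
      congr 1
      ring
  have hfin := lintegral_exp_mul_abs_det_ne_top (freqMatrix M)
  rw [hcomp] at hfin
  have hcpos : 0 < fiberConst (momentMatrix M) * (trigScale L ^ L)⁻¹ := by positivity
  -- Integrability is pulled back through `hcomp` from the coefficient space, where it is already
  -- known.
  have hint : Integrable fun x : SymIdx L → ℝ =>
      Real.exp (-(1 / 2) * (((covMatrix M)⁻¹).mulVec x ⬝ᵥ x)) * |(symMatrix x).det| := by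
    refine ⟨hJc.aestronglyMeasurable, ?_⟩
    rw [hasFiniteIntegral_iff_ofReal (Filter.Eventually.of_forall hJ0), lt_top_iff_ne_top]
    intro htop
    rw [htop, ENNReal.mul_top (ENNReal.ofReal_pos.2 hcpos).ne'] at hfin
    exact hfin rfl
  rw [expectedCritical_trigSpace hM hne hA, hcomp, ← ofReal_integral_eq_lintegral_ofReal hint
    (Filter.Eventually.of_forall hJ0), ← mul_assoc, ← fiberConst_mul_fiberConst hL hM hs hA,
    ← ENNReal.ofReal_mul (by unfold fiberConst; positivity), ← ENNReal.ofReal_mul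
      (by unfold fiberConst; positivity), ← ENNReal.ofReal_div_of_pos (by positivity)]
  congr 1
  ring

end Main

end TrigNewton

end

theorem theorem3p1 (L : ℕ) (hL : 0 < L) (M : Finset (Fin L → ℤ))
    (hM : ∀ m ∈ M, m ∈ TrigNewton.posCone L) (hsymm : TrigNewton.IsSymmetric M)
    (hcard : L < M.card) :
    (TrigNewton.IsAmple (TrigNewton.trigSpace M) ↔
      TrigNewton.aDiag M ≠ TrigNewton.bOff M ∧
        TrigNewton.aDiag M + ((L : ℝ) - 1) * TrigNewton.bOff M ≠ 0) ∧
    (LinearIndependent ℝ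
        (fun p : TrigNewton.SymIdx L => TrigNewton.aVec M p.1.1 p.1.2) →
      (∀ p q : TrigNewton.SymIdx L, TrigNewton.covMatrix M p q =
        2 / (2 * Real.pi) ^ L *
          ∑ m ∈ M, (m p.1.1 : ℝ) * (m p.1.2 : ℝ) * (m q.1.1 : ℝ) * (m q.1.2 : ℝ)) ∧
      TrigNewton.expectedCritical (TrigNewton.trigSpace M) =
        ENNReal.ofReal
          (1 / ((2 * Real.pi) ^ ((1 / 2 : ℝ) * (L.choose 2 : ℝ)) *
              (TrigNewton.aDiag M - TrigNewton.bOff M) ^ (((L : ℝ) - 1) / 2) *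
              (TrigNewton.aDiag M + ((L : ℝ) - 1) * TrigNewton.bOff M) ^ (1 / 2 : ℝ) *
              (TrigNewton.covMatrix M).det ^ (1 / 2 : ℝ)) *
            ∫ x : TrigNewton.SymIdx L → ℝ,
              Real.exp (-(1 / 2) * (((TrigNewton.covMatrix M)⁻¹).mulVec x ⬝ᵥ x)) *
                |(TrigNewton.symMatrix x).det|)) :=
  ⟨TrigNewton.isAmple_trigSpace_iff_ne hL hM hsymm, fun hlin =>
    ⟨TrigNewton.covMatrix_apply hM, TrigNewton.expectedCritical_eq hL hM hsymm
      (Finset.card_pos.1 (hL.trans hcard)) hlin⟩⟩
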